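/- Let $A,B$ be unital complex Banach algebras, and let $\varphi:A\to\mathbb C$ and $\Phi:A\to B$ be unital linear maps; put $A^\circ=A\setminus\ker\varphi$. **c-freeness.** Unital subalgebras $A_1,A_2\subseteq A$ are *c-free* with respect to $(\Phi,\varphi)$ if for all $n\ge 1$ and all $a_1,\dots,a_n$ with $a_j\in A_{\varepsilon(j)}$, $\varepsilon(j)\in\{1,2\}$, $\varepsilon(j)\ne\varepsilon(j+1)$ and $\varphi(a_j)=0$ one has $\varphi(a_1\cdots a_n)=0$ and $\Phi(a_1\cdots a_n)=\Phi(a_1)\cdots\Phi(a_n)$. Elements $X,Y\in A$ are c-free if the unital subalgebras that they generate are. **Non-crossing linked partitions.** $NCL(n)$ is the set of all families $\pi$ of non-empty subsets (blocks) of $\{1,\dots,n\}$ that cover $\{1,\dots,n\}$, such that for any two different blocks $C,D$ there are no $i<k<p<q$ with $i,p\in C$ and $k,q\in D$, and $C,D$ are either disjoint or meet in a single element $j$, where in the latter case $|C|,|D|\ge2$ and $j$ is the minimal element of exactly one of $C,D$. Let $s(\pi)$ be the set of elements that are not the minimal element of any block. A block $C$ is *interior* if some block $D$ of $\pi$ has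 elements $l,s$ with $l<\min C\le s$, and *exterior* otherwise. **Coefficients.** For $n\ge1$, $X_1\in A$ and $X_2,\dots,X_n\in A^\circ$, the coefficients $t_{n-1}(X_1,\dots,X_n)\in\mathbb C$ and ${}^ct_{n-1}(X_1,\dots,X_n)\in B$ are defined by the recurrences $$\varphi(X_1\cdots X_n)=\sum_{\pi\in NCL(n)}\ \prod_{\substack{C\in\pi\\ C=(i_1<\dots<i_l)}}t_{l-1}(X_{i_1},\dots,X_{i_l})\prod_{p\in s(\pi)}t_0(X_p),$$ $$\Phi(X_1\cdots X_n)=\sum_{\pi\in NCL(n)}\ \Big[\prod_{\substack{C\in\pi\text{ exterior}\\ C=(i_1<\dots<i_l)}}{}^ct_{l-1}(X_{i_1},\dots,X_{i_l})\Big]\prod_{\substack{D\in\pi\text{ interior}\\ D=(j_1<\dots<j_r)}}t_{r-1}(X_{j_1},\dots,X_{j_r})\prod_{p\in s(\pi)}t_0(X_p),$$ where the product over the exterior blocks is taken in the order of their first elements. For $X,Y\in A^\circ$, *all mixed $t$- and ${}^ct$-coefficients of $X$ and $Y$ vanish* means: for all $n$ and all $c_1,\dots,c_n\in\{0,1\}$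 that are not all equal, with $a_i=X$ if $c_i=0$ and $a_i=Y$ if $c_i=1$, one has ${}^ct_{n-1}(a_1,\dots,a_n)=t_{n-1}(a_1,\dots,a_n)=0$. **Proposition.** (1) Elements $X,Y\in A^\circ$ are c-free with respect to $(\Phi,\varphi)$ if and only if all their mixed $t$- and ${}^ct$-coefficients vanish. (2) Suppose moreover that $A,B$ are unital C$^*$-algebras, $\varphi$ is positive and $\Phi$ is completely positive, and let $X,Y\in A^\circ$. If the unital C$^*$-subalgebras generated by $X$ and by $Y$ are c-free with respect to $(\Phi,\varphi)$, then all mixed $t$- and ${}^ct$-coefficients of $X$ and $Y$ vanish. The converse holds if $X^*$ lies in the norm-closed unital subalgebra generated by $X$ and $Y^*$ in the one generated by $Y$ (for example if $X$ and $Y$ are self-adjoint). -/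

import Mathlib

open Finset
open scoped CStarAlgebra ComplexOrder

namespace CFreeness

/-! ### Non-crossing linked partitions of `{1, …, n}`, modelled on `Fin n` -/

/-- Two blocks do not cross: there are no `i < k < p < q` with `i, p` in the first one and `k, q` in
the second one. -/
def NonCrossing {n : ℕ} (C D : Finset (Fin n)) : Prop :=
  ∀ i ∈ C, ∀ k ∈ D, ∀ p ∈ C, ∀ q ∈ D, ¬ (i < k ∧ k < p ∧ p < q)

/-- `j` is the minimal element of `C`. -/
def IsMinOf {n : ℕ} (j : Fin n) (C : Finset (Fin n)) : Prop :=
  j ∈ C ∧ ∀ i ∈ C, j ≤ i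

/-- `π` is a non-crossing linked partition: its blocks are non-empty and cover `{1, …, n}`, they do
not cross, and two different blocks are either disjoint or meet in exactly one element `j`, in which
case both have at least two elements and `j` is the minimal element of exactly one of them. -/
structure IsNCL {n : ℕ} (π : Finset (Finset (Fin n))) : Prop where
  nonempty : ∀ C ∈ π, C.Nonempty
  cover : ∀ i : Fin n, ∃ C ∈ π, i ∈ C
  nonCrossing : ∀ C ∈ π, ∀ D ∈ π, C ≠ D → NonCrossing C D
  card_inter : ∀ C ∈ π, ∀ D ∈ π, C ≠ D → (C ∩ D).card ≤ 1
  linked : ∀ C ∈ π, ∀ D ∈ π, C ≠ D → ∀ j ∈ C ∩ D,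
    2 ≤ C.card ∧ 2 ≤ D.card ∧ Xor (IsMinOf j C) (IsMinOf j D)

open scoped Classical in
/-- The set `NCL(n)`. -/
noncomputable def NCL (n : ℕ) : Finset (Finset (Finset (Fin n))) :=
  univ.filter fun π => IsNCL π

open scoped Classical in
/-- `s(π)`: the elements that are not the minimal element of any block of `π`. -/
noncomputable def nonMinima {n : ℕ} (π : Finset (Finset (Fin n))) : Finset (Fin n) :=
  univ.filter fun k => ∀ C ∈ π, ¬ IsMinOf k C

/-- The block `C` of `π` is interior: some block of `π` has elements `l, s` with `l < i₁ ≤ s`, where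
`i₁` is the minimal element of `C`. So a block is interior if it is nested in another block or hangs
on a non-minimal element of another block. -/
def IsInterior {n : ℕ} (π : Finset (Finset (Fin n))) (C : Finset (Fin n)) : Prop :=
  ∃ D ∈ π, ∃ l ∈ D, ∃ s ∈ D, ∃ i, IsMinOf i C ∧ l < i ∧ i ≤ s

open scoped Classical in
/-- The interior blocks of `π`. -/
noncomputable def intBlocks {n : ℕ} (π : Finset (Finset (Fin n))) : Finset (Finset (Fin n)) :=
  π.filter fun C => IsInterior π C

open scoped Classical in
/-- The exterior blocks of `π`. -/
noncomputable def extBlocks {n : ℕ} (π : Finset (Finset (Fin n))) : Finset (Finset (Fin n)) :=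
  π.filter fun C => ¬ IsInterior π C

open scoped Classical in
/-- The exterior blocks of `π`, listed by increasing first element. (Different blocks of a
non-crossing linked partition never have the same first element.) -/
noncomputable def extList {n : ℕ} (π : Finset (Finset (Fin n))) : List (Finset (Fin n)) :=
  (List.finRange n).flatMap fun i => ((extBlocks π).filter fun C => IsMinOf i C).toList

theorem card_lt_of_mem {n : ℕ} {π : Finset (Finset (Fin n))} (hπ : univ ∉ π)
    {C : Finset (Fin n)} (hC : C ∈ π) : C.card < n := by
  have h : C ≠ univ := fun h => hπ (h ▸ hC)
  simpa using (Finset.card_lt_iff_ne_univ C).2 h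

theorem mem_of_mem_intBlocks {n : ℕ} {π : Finset (Finset (Fin n))} {C : Finset (Fin n)}
    (hC : C ∈ intBlocks π) : C ∈ π := by
  classical
  simp only [intBlocks, Finset.mem_filter] at hC
  exact hC.1

theorem mem_of_mem_extList {n : ℕ} {π : Finset (Finset (Fin n))} {C : Finset (Fin n)}
    (hC : C ∈ extList π) : C ∈ π := by
  classical
  simp only [extList, List.mem_flatMap, Finset.mem_toList, Finset.mem_filter, extBlocks] at hC
  obtain ⟨_, _, h, _⟩ := hC
  exact h.1

/-! ### The coefficients -/

section Coefficients

variable {A : Type*} [Ring A] [Algebra ℂ A] {B : Type*} [Ring B] [Algebra ℂ B]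

/-- The tuple `(X_{i₁}, …, X_{iₗ})`, where `C = (i₁ < ⋯ < iₗ)`. -/
def restr {n : ℕ} (X : Fin n → A) (C : Finset (Fin n)) : Fin C.card → A :=
  fun j => X (C.orderEmbOfFin rfl j)

/-- The product `X₁ ⋯ Xₙ` in this order. -/
def oprod {R : Type*} [Monoid R] {n : ℕ} (X : Fin n → R) : R := (List.ofFn X).prod

/-- `tCoeff φ n (X₁, …, Xₙ)` is the coefficient `t_{n-1}(X₁, …, Xₙ)` (for `n ≥ 1` and
`φ(X₂), …, φ(Xₙ) ≠ 0`). It is obtained by solving the recurrence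
`φ(X₁ ⋯ Xₙ) = ∑_{π ∈ NCL(n)} ∏_{C ∈ π} t_{|C|-1}(X_{i₁}, …, X_{iₗ}) ∏_{p ∈ s(π)} t₀(X_p)`
for the factor `t_{n-1}(X₁, …, Xₙ)` of the summand at the one-block partition; `t₀ = φ`. See
`phi_oprod` for the recurrence itself. -/
noncomputable def tCoeff (φ : A →ₗ[ℂ] ℂ) (n : ℕ) (X : Fin n → A) : ℂ :=
  (φ (oprod X) -
    ∑ π : {π // π ∈ (NCL n).filter fun π => univ ∉ π},
      (∏ C : {C // C ∈ π.1}, tCoeff φ C.1.card (restr X C.1)) * ∏ p ∈ nonMinima π.1, φ (X p)) /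
  ∏ p ∈ univ.filter (fun p : Fin n => 0 < p.val), φ (X p)
termination_by n
decreasing_by exact card_lt_of_mem (Finset.mem_filter.1 π.2).2 C.2

/-- `ctCoeff Φ φ n (X₁, …, Xₙ)` is the coefficient `ᶜt_{n-1}(X₁, …, Xₙ)` (for `n ≥ 1` and
`φ(X₂), …, φ(Xₙ) ≠ 0`), obtained in the same way from the recurrence that `Phi_oprod` states. -/
noncomputable def ctCoeff (Φ : A →ₗ[ℂ] B) (φ : A →ₗ[ℂ] ℂ) (n : ℕ) (X : Fin n → A) : B :=
  (∏ p ∈ univ.filter (fun p : Fin n => 0 < p.val), φ (X p))⁻¹ •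
  (Φ (oprod X) -
    ∑ π : {π // π ∈ (NCL n).filter fun π => univ ∉ π},
      ((∏ D ∈ intBlocks π.1, tCoeff φ D.card (restr X D)) * ∏ p ∈ nonMinima π.1, φ (X p)) •
        ((extList π.1).attach.map fun C => ctCoeff Φ φ C.1.card (restr X C.1)).prod)
termination_by n
decreasing_by exact card_lt_of_mem (Finset.mem_filter.1 π.2).2 (mem_of_mem_extList C.2)

/-- The summand `t_π[X₁, …, Xₙ]`. -/
noncomputable def tPi (φ : A →ₗ[ℂ] ℂ) {n : ℕ} (π : Finset (Finset (Fin n))) (X : Fin n → A) : ℂ :=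
  (∏ C ∈ π, tCoeff φ C.card (restr X C)) * ∏ p ∈ nonMinima π, tCoeff φ 1 (fun _ => X p)

/-- The summand `ᶜt_π[X₁, …, Xₙ]`; the product over the exterior blocks is ordered by their first
elements. -/
noncomputable def ctPi (Φ : A →ₗ[ℂ] B) (φ : A →ₗ[ℂ] ℂ) {n : ℕ} (π : Finset (Finset (Fin n)))
    (X : Fin n → A) : B :=
  ((∏ D ∈ intBlocks π, tCoeff φ D.card (restr X D)) *
      ∏ p ∈ nonMinima π, tCoeff φ 1 (fun _ => X p)) •
    ((extList π).map fun C => ctCoeff Φ φ C.card (restr X C)).prod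

theorem univ_mem_NCL {n : ℕ} (hn : 1 ≤ n) {π : Finset (Finset (Fin n))} :
    π ∈ NCL n ∧ univ ∈ π ↔ π = {univ} := by
  classical
  have : NeZero n := ⟨by omega⟩
  constructor
  · rintro ⟨h, hu⟩
    have h : IsNCL π := by simpa [NCL] using h
    refine Finset.eq_singleton_iff_unique_mem.2 ⟨hu, fun C hC => ?_⟩
    by_contra hne
    obtain ⟨j, hj⟩ := h.nonempty C hC
    have h1 := h.card_inter C hC univ hu hne
    have h2 := (h.linked C hC univ hu hne j (by simpa using hj)).1
    simp at h1
    omega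
  · rintro rfl
    refine ⟨?_, by simp⟩
    simp only [NCL, Finset.mem_filter, Finset.mem_univ, true_and]
    refine ⟨?_, ?_, ?_, ?_, ?_⟩
    · intro C hC; simp only [mem_singleton] at hC; subst hC; exact Finset.univ_nonempty
    · intro i; exact ⟨univ, by simp, by simp⟩
    all_goals
      intro C hC D hD hne
      simp only [mem_singleton] at hC hD
      exact absurd (hC.trans hD.symm) hne

theorem NCL_one : ((NCL 1).filter fun π => univ ∉ π) = ∅ := by
  classical
  refine Finset.filter_eq_empty_iff.2 fun π hπ hu => ?_
  have h : IsNCL π := by simpa [NCL] using hπ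
  obtain ⟨C, hC, h0⟩ := h.cover 0
  refine hu ?_
  have : C = univ := Finset.eq_univ_iff_forall.2 fun i => by rwa [Subsingleton.elim i 0]
  exact this ▸ hC

theorem tCoeff_one (φ : A →ₗ[ℂ] ℂ) (X : Fin 1 → A) : tCoeff φ 1 X = φ (X 0) := by
  rw [tCoeff, Finset.sum_coe_sort ((NCL 1).filter fun π => univ ∉ π) (fun π =>
      (∏ C : {C // C ∈ π}, tCoeff φ C.1.card (restr X C.1)) * ∏ p ∈ nonMinima π, φ (X p)),
    NCL_one]
  simp [oprod]

theorem sum_NCL {M : Type*} [AddCommMonoid M] {n : ℕ} (hn : 1 ≤ n)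
    (f : Finset (Finset (Fin n)) → M) :
    ∑ π ∈ NCL n, f π = f {univ} + ∑ π ∈ (NCL n).filter (fun π => univ ∉ π), f π := by
  classical
  rw [← Finset.sum_filter_add_sum_filter_not (NCL n) (fun π => univ ∈ π)]
  have : (NCL n).filter (fun π => univ ∈ π) = {{univ}} := by
    ext π
    rw [Finset.mem_filter, univ_mem_NCL hn, Finset.mem_singleton]
  rw [this, Finset.sum_singleton]

theorem nonMinima_univ {n : ℕ} :
    nonMinima {(univ : Finset (Fin n))} = univ.filter fun p : Fin n => 0 < p.val := by
  classical
  ext p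
  simp only [nonMinima, IsMinOf, mem_filter, mem_univ, true_and, mem_singleton, forall_eq,
    forall_const, not_forall, not_le]
  constructor
  · rintro ⟨i, hi⟩
    exact lt_of_le_of_lt (Nat.zero_le _) hi
  · intro h
    exact ⟨⟨0, by omega⟩, h⟩

set_option linter.unusedSectionVars false in
theorem restr_univ {M : Type*} (F : (m : ℕ) → (Fin m → A) → M) {n : ℕ} (X : Fin n → A) :
    F (univ : Finset (Fin n)).card (restr X univ) = F n X := by
  have key : ∀ (m : ℕ) (h : (univ : Finset (Fin n)).card = m) (hm : m = n),
      F (univ : Finset (Fin n)).card (restr X univ) =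
        F m (fun j => X ((univ : Finset (Fin n)).orderEmbOfFin h j)) := by
    intro m h hm; subst h; rfl
  rw [key n (by simp) rfl]
  congr 1
  funext j
  congr 1
  have : ((fun j : Fin n => j) : Fin n → Fin n) =
      (univ : Finset (Fin n)).orderEmbOfFin (by simp) :=
    Finset.orderEmbOfFin_unique (by simp) (by simp) strictMono_id
  exact (congrFun this j).symm

theorem prod_ne_zero {φ : A →ₗ[ℂ] ℂ} {n : ℕ} {X : Fin n → A}
    (hX : ∀ p : Fin n, 0 < p.val → φ (X p) ≠ 0) :
    ∏ p ∈ univ.filter (fun p : Fin n => 0 < p.val), φ (X p) ≠ 0 :=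
  Finset.prod_ne_zero_iff.2 fun p hp => hX p (Finset.mem_filter.1 hp).2

/-- The recurrence that defines the `t`-coefficients. -/
theorem phi_oprod (φ : A →ₗ[ℂ] ℂ) {n : ℕ} (hn : 1 ≤ n) (X : Fin n → A)
    (hX : ∀ p : Fin n, 0 < p.val → φ (X p) ≠ 0) :
    φ (oprod X) = ∑ π ∈ NCL n, tPi φ π X := by
  rw [sum_NCL hn]
  have h1 : tPi φ {univ} X =
      tCoeff φ n X * ∏ p ∈ univ.filter (fun p : Fin n => 0 < p.val), φ (X p) := by
    simp only [tPi, prod_singleton, tCoeff_one, nonMinima_univ]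
    rw [restr_univ (tCoeff φ)]
  rw [h1, tCoeff, div_mul_cancel₀ _ (prod_ne_zero hX),
    Finset.sum_coe_sort ((NCL n).filter fun π => univ ∉ π) (fun π =>
      (∏ C : {C // C ∈ π}, tCoeff φ C.1.card (restr X C.1)) * ∏ p ∈ nonMinima π, φ (X p))]
  have h2 : ∀ π : Finset (Finset (Fin n)), tPi φ π X =
      (∏ C : {C // C ∈ π}, tCoeff φ C.1.card (restr X C.1)) * ∏ p ∈ nonMinima π, φ (X p) := by
    intro π
    rw [Finset.prod_coe_sort π (fun C => tCoeff φ C.card (restr X C))]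
    simp only [tPi, tCoeff_one]
  simp only [h2]
  ring

theorem extList_univ {n : ℕ} (hn : 1 ≤ n) : extList {(univ : Finset (Fin n))} = [univ] := by
  classical
  obtain ⟨m, rfl⟩ : ∃ m, n = m + 1 := ⟨n - 1, by omega⟩
  have hmin : ∀ i : Fin (m + 1), IsMinOf i (univ : Finset (Fin (m + 1))) ↔ i = 0 := by
    intro i
    simp only [IsMinOf, mem_univ, true_and, forall_const]
    exact ⟨fun h => le_antisymm (h 0) (Fin.zero_le i), fun h j => h ▸ Fin.zero_le j⟩
  have hext : extBlocks {(univ : Finset (Fin (m + 1)))} = {univ} := by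
    simp only [extBlocks]
    refine Finset.filter_true_of_mem fun C hC => ?_
    rw [Finset.mem_singleton] at hC
    subst hC
    rintro ⟨D, _, l, _, s, _, i, hi, hl, _⟩
    rw [hmin] at hi
    subst hi
    exact absurd hl (not_lt.2 (Fin.zero_le l))
  rw [extList, List.finRange_succ, List.flatMap_cons, hext]
  have h0 : (({univ} : Finset (Finset (Fin (m + 1)))).filter fun C => IsMinOf 0 C).toList
      = [univ] := by
    rw [Finset.filter_true_of_mem, Finset.toList_singleton]
    intro C hC
    rw [Finset.mem_singleton] at hC
    subst hC
    exact (hmin 0).2 rfl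
  rw [h0, List.flatMap_map, List.flatMap_eq_nil_iff.2, List.append_nil]
  intro i _
  rw [Finset.filter_false_of_mem, Finset.toList_empty]
  intro C hC
  rw [Finset.mem_singleton] at hC
  subst hC
  rw [hmin]
  exact Fin.succ_ne_zero i

theorem intBlocks_univ {n : ℕ} : intBlocks {(univ : Finset (Fin n))} = ∅ := by
  classical
  refine Finset.filter_eq_empty_iff.2 fun C hC => ?_
  rw [Finset.mem_singleton] at hC
  subst hC
  rintro ⟨D, _, l, _, s, _, i, hi, hl, _⟩
  exact absurd (hi.2 l (Finset.mem_univ l)) (not_le.2 hl)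

/-- The recurrence that defines the `ᶜt`-coefficients. -/
theorem Phi_oprod (Φ : A →ₗ[ℂ] B) (φ : A →ₗ[ℂ] ℂ) {n : ℕ} (hn : 1 ≤ n) (X : Fin n → A)
    (hX : ∀ p : Fin n, 0 < p.val → φ (X p) ≠ 0) :
    Φ (oprod X) = ∑ π ∈ NCL n, ctPi Φ φ π X := by
  rw [sum_NCL hn]
  have h1 : ctPi Φ φ {univ} X =
      (∏ p ∈ univ.filter (fun p : Fin n => 0 < p.val), φ (X p)) • ctCoeff Φ φ n X := by
    simp only [ctPi, tCoeff_one, nonMinima_univ, intBlocks_univ, extList_univ hn,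
      List.map_cons, List.map_nil, List.prod_cons, List.prod_nil, mul_one, prod_empty, one_mul]
    rw [restr_univ (ctCoeff Φ φ)]
  rw [h1, ctCoeff, smul_inv_smul₀ (prod_ne_zero hX),
    Finset.sum_coe_sort ((NCL n).filter fun π => univ ∉ π) (fun π =>
      ((∏ D ∈ intBlocks π, tCoeff φ D.card (restr X D)) * ∏ p ∈ nonMinima π, φ (X p)) •
        ((extList π).attach.map fun C => ctCoeff Φ φ C.1.card (restr X C.1)).prod)]
  have h2 : ∀ π : Finset (Finset (Fin n)), ctPi Φ φ π X =
      ((∏ D ∈ intBlocks π, tCoeff φ D.card (restr X D)) * ∏ p ∈ nonMinima π, φ (X p)) •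
        ((extList π).attach.map fun C => ctCoeff Φ φ C.1.card (restr X C.1)).prod := by
    intro π
    have h3 : (extList π).attach.map (fun C => ctCoeff Φ φ C.1.card (restr X C.1)) =
        (extList π).map fun C => ctCoeff Φ φ C.card (restr X C) := by
      conv_rhs => rw [← List.attach_map_subtype_val (extList π), List.map_map]
      rfl
    rw [h3]
    simp only [ctPi, tCoeff_one]
  simp only [h2, sub_add_cancel]

/-- All mixed `t`- and `ᶜt`-coefficients of `X` and `Y` vanish. The argument in position `i` is `X`
if `c i = 0` and `Y` if `c i = 1`, and both have to occur. -/
def MixedCoeffsVanish (Φ : A →ₗ[ℂ] B) (φ : A →ₗ[ℂ] ℂ) (X Y : A) : Prop :=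
  ∀ (n : ℕ) (c : Fin n → Fin 2), (∃ k, c k = 0) → (∃ l, c l = 1) →
    ctCoeff Φ φ n (fun i => ![X, Y] (c i)) = 0 ∧ tCoeff φ n (fun i => ![X, Y] (c i)) = 0

/-- The unital subalgebras `A₁` and `A₂` are c-free with respect to `(Φ, φ)`. -/
def CFree (Φ : A →ₗ[ℂ] B) (φ : A →ₗ[ℂ] ℂ) (A₁ A₂ : Subalgebra ℂ A) : Prop :=
  ∀ (n : ℕ), 1 ≤ n → ∀ (ε : Fin n → Fin 2) (a : Fin n → A),
    (∀ j, φ (a j) = 0) → (∀ j, a j ∈ ![A₁, A₂] (ε j)) →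
    (∀ j k : Fin n, k.val = j.val + 1 → ε j ≠ ε k) →
    φ (oprod a) = 0 ∧ Φ (oprod a) = oprod fun j => Φ (a j)

/-- The set `A° = A \ ker φ`. -/
def Acirc (φ : A →ₗ[ℂ] ℂ) : Set A := {a | φ a ≠ 0}

end Coefficients

end CFreeness

/-!
The coefficients are the weights of a concrete model of the joint moments of `X` and `Y`, which is
c-free exactly when the mixed weights vanish. The C*-statement follows by density.

*The model.* Read a word `X₁ ⋯ Xₙ` from the right. Given a non-crossing linked partition, every
position is the minimal element of exactly one block, if a one-element block is added at every
element of `s(π)`. Reading a position `k` closes the block that `k` is the minimal element of,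
whose other elements are the top entries of a stack of open positions; then `k` may itself be put on
the stack, to be used by a block that starts further to the left. A block is exterior exactly if
nothing is open after its minimal element has been read. So the operator `stackOp t κ a` on the words
in the letters removes a prefix `u` at the price of `t (a :: u)` (or `κ (a :: u)` if the stack is
empty afterwards) and then pushes `a` or not, and the vacuum expectation of a product of such operators
is the sum over `NCL(n)` in the recurrences. The encoding of partitions as families of tails
(`sum_NCL_eq_sum_isTail`), the recursion `openSum_step` and the step `stackState_step` lead to this
fact, `stackOp_prod_apply_nil`. Hence `comp_lift_eq_vacuum`: on the free algebra, `φ` and `Φ` are the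
vacuum expectations of the stack model whose weights are the coefficients.

*Pure weights give c-freeness.* If words with different letters have weight `0`, then a polynomial in
the letter `a` acts on a word that starts with another letter as it does on the vacuum. So a centred
polynomial in `a` maps words that start with another letter to words that start with `a`, and the
vacuum `Ω` to its expectation times `Ω` plus such words (`stackRep_oprod_sub_mem`,
`cfree_vacuum`).

*C-freeness gives pure weights.* C-freeness determines the moments from those of the single letters
(`eq_of_cfree`), for which only the pure weights matter (`vacuum_purePart_eq_on_adjoin`). So the
moments are those of the c-free model with the pure weights, and the recurrence determines the weights
from the moments (`weights_eq_of_vacuum_eq`).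

*C*-algebras.* Positive maps are continuous, and a centred element of the closure of a subalgebra is a
limit of centred elements, so c-freeness passes to closures (`CFree.topologicalClosure`).
-/

namespace CFreeness

/-! ### Non-crossing linked partitions as families of tails -/

section Tails

variable {n : ℕ}

/-- A family of tails: `f i` stands for the block with minimal element `i`, with `i` removed. It is
empty if `{i}` is a block, and also if `i` is not the minimal element of any block. The single
condition `nested` encodes both that blocks do not cross and that tails are disjoint. -/
structure IsTail (f : Fin n → Finset (Fin n)) : Prop where
  lt : ∀ i, ∀ p ∈ f i, i < p
  nested : ∀ i j p q, i < j → p ∈ f i → q ∈ f j → j < p → q < p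

/-- The position `i` is covered by an arc of the family `f`. For the minimal element of a block this
says that the block is interior; an element of a tail is always covered. -/
def IsCovered (f : Fin n → Finset (Fin n)) (i : Fin n) : Prop :=
  ∃ j, j < i ∧ ∃ p ∈ f j, i ≤ p

open scoped Classical in
/-- The family of tails of `π`. -/
noncomputable def tails (π : Finset (Finset (Fin n))) (i : Fin n) : Finset (Fin n) :=
  univ.filter fun p => i < p ∧ ∃ C ∈ π, IsMinOf i C ∧ p ∈ C

open scoped Classical in
/-- The blocks of a family of tails: an element of a tail starts a block only if its own tail is not
empty. -/
noncomputable def blocks (f : Fin n → Finset (Fin n)) : Finset (Finset (Fin n)) :=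
  (univ.filter fun i => (f i).Nonempty ∨ ∀ j, i ∉ f j).image fun i => insert i (f i)

theorem mem_tails {π : Finset (Finset (Fin n))} {i p : Fin n} :
    p ∈ tails π i ↔ i < p ∧ ∃ C ∈ π, IsMinOf i C ∧ p ∈ C := by
  simp [tails]

theorem mem_blocks {f : Fin n → Finset (Fin n)} {C : Finset (Fin n)} :
    C ∈ blocks f ↔ ∃ i, ((f i).Nonempty ∨ ∀ j, i ∉ f j) ∧ insert i (f i) = C := by
  simp [blocks]

theorem mem_NCL {π : Finset (Finset (Fin n))} : π ∈ NCL n ↔ IsNCL π := by simp [NCL]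

theorem IsMinOf.unique {i j : Fin n} {C : Finset (Fin n)} (hi : IsMinOf i C) (hj : IsMinOf j C) :
    i = j := le_antisymm (hi.2 j hj.1) (hj.2 i hi.1)

theorem exists_isMinOf {C : Finset (Fin n)} (hC : C.Nonempty) : ∃ i, IsMinOf i C :=
  ⟨C.min' hC, C.min'_mem hC, fun i hi => C.min'_le i hi⟩

theorem IsTail.isMinOf {f : Fin n → Finset (Fin n)} (hf : IsTail f) {i j : Fin n} :
    IsMinOf i (insert j (f j)) ↔ i = j := by
  constructor
  · rintro ⟨h1, h2⟩
    rcases mem_insert.1 h1 with h | h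
    · exact h
    · exact absurd (h2 j (mem_insert_self _ _)) (not_le.2 (hf.lt _ _ h))
  · rintro rfl
    refine ⟨mem_insert_self _ _, fun k hk => ?_⟩
    rcases mem_insert.1 hk with h | h
    · exact h.ge
    · exact (hf.lt _ _ h).le

theorem IsNCL.eq_of_isMinOf {π : Finset (Finset (Fin n))} (hπ : IsNCL π) {C D : Finset (Fin n)}
    (hC : C ∈ π) (hD : D ∈ π) {i : Fin n} (h : IsMinOf i C) (h' : IsMinOf i D) : C = D := by
  by_contra hne
  have := (hπ.linked C hC D hD hne i (mem_inter.2 ⟨h.1, h'.1⟩)).2.2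
  rcases this with ⟨_, h2⟩ | ⟨_, h2⟩
  · exact h2 h'
  · exact h2 h

theorem IsNCL.insert_tails {π : Finset (Finset (Fin n))} (hπ : IsNCL π) {C : Finset (Fin n)}
    (hC : C ∈ π) {i : Fin n} (h : IsMinOf i C) : insert i (tails π i) = C := by
  ext p
  rw [mem_insert, mem_tails]
  constructor
  · rintro (rfl | ⟨_, D, hD, hi, hp⟩)
    · exact h.1
    · rwa [hπ.eq_of_isMinOf hC hD h hi]
  · intro hp
    rcases (h.2 p hp).eq_or_lt with h' | h'
    · exact Or.inl h'.symm
    · exact Or.inr ⟨h', C, hC, h, hp⟩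

/-- An element that is in no tail starts a block. -/
theorem IsNCL.exists_isMinOf {π : Finset (Finset (Fin n))} (hπ : IsNCL π) {i : Fin n}
    (h : ∀ j, i ∉ tails π j) : ∃ C ∈ π, IsMinOf i C := by
  obtain ⟨C, hC, hi⟩ := hπ.cover i
  obtain ⟨j, hj⟩ := CFreeness.exists_isMinOf ⟨i, hi⟩
  rcases (hj.2 i hi).eq_or_lt with h' | h'
  · exact ⟨C, hC, h' ▸ hj⟩
  · exact absurd (mem_tails.2 ⟨h', C, hC, hj, hi⟩) (h j)

theorem IsNCL.isTail {π : Finset (Finset (Fin n))} (hπ : IsNCL π) : IsTail (tails π) := by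
  refine ⟨fun i p hp => (mem_tails.1 hp).1, fun i j p q hij hp hq hjp => ?_⟩
  obtain ⟨hip, C, hC, hiC, hpC⟩ := mem_tails.1 hp
  obtain ⟨hjq, D, hD, hjD, hqD⟩ := mem_tails.1 hq
  have hne : C ≠ D := by
    rintro rfl
    exact hij.ne (hiC.unique hjD)
  by_contra hlt
  rcases (not_lt.1 hlt).eq_or_lt with rfl | h
  · rcases (hπ.linked C hC D hD hne p (mem_inter.2 ⟨hpC, hqD⟩)).2.2 with ⟨h, _⟩ | ⟨h, _⟩
    · exact hip.ne' (h.unique hiC)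
    · exact hjq.ne' (h.unique hjD)
  · exact hπ.nonCrossing C hC D hD hne i hiC.1 j hjD.1 p hpC q hqD ⟨hij, hjp, h⟩

theorem IsNCL.blocks_tails {π : Finset (Finset (Fin n))} (hπ : IsNCL π) :
    blocks (tails π) = π := by
  ext C
  rw [mem_blocks]
  constructor
  · rintro ⟨i, ⟨p, hp⟩ | h, rfl⟩
    · obtain ⟨_, D, hD, hi, _⟩ := mem_tails.1 hp
      rwa [hπ.insert_tails hD hi]
    · obtain ⟨D, hD, hi⟩ := hπ.exists_isMinOf h
      rwa [hπ.insert_tails hD hi]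
  · intro hC
    obtain ⟨i, hi⟩ := CFreeness.exists_isMinOf (hπ.nonempty C hC)
    have hB := hπ.insert_tails hC hi
    refine ⟨i, ?_, hB⟩
    by_contra! h
    obtain ⟨h1, j, hj⟩ := h
    obtain ⟨hji, D, hD, hjD, hiD⟩ := mem_tails.1 hj
    have hne : C ≠ D := by
      rintro rfl
      exact hji.ne (hjD.unique hi)
    have hc := (hπ.linked C hC D hD hne i (mem_inter.2 ⟨hi.1, hiD⟩)).1
    rw [← hB, h1] at hc
    simp at hc

theorem IsTail.tails_blocks {f : Fin n → Finset (Fin n)} (hf : IsTail f) :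
    tails (blocks f) = f := by
  funext i
  ext p
  rw [mem_tails]
  constructor
  · rintro ⟨hip, C, hC, hi, hp⟩
    obtain ⟨j, _, rfl⟩ := mem_blocks.1 hC
    obtain rfl := hf.isMinOf.1 hi
    exact (mem_insert.1 hp).resolve_left hip.ne'
  · intro hp
    exact ⟨hf.lt i p hp, _, mem_blocks.2 ⟨i, Or.inl ⟨p, hp⟩, rfl⟩, hf.isMinOf.2 rfl,
      mem_insert_of_mem hp⟩

/-- Two blocks of a family of tails meet at most in the minimal element of the second one. -/
theorem IsTail.eq_of_mem_inter {f : Fin n → Finset (Fin n)} (hf : IsTail f) {i j x : Fin n}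
    (hij : i < j) (hx : x ∈ insert i (f i) ∩ insert j (f j)) : x = j ∧ j ∈ f i := by
  obtain ⟨h1, h2⟩ := mem_inter.1 hx
  rcases mem_insert.1 h1 with rfl | h1 <;> rcases mem_insert.1 h2 with rfl | h2
  · exact absurd rfl hij.ne
  · exact absurd (hf.lt _ _ h2) hij.asymm
  · exact ⟨rfl, h1⟩
  · exact absurd (hf.nested i j x x hij h1 h2 (hf.lt _ _ h2)) (lt_irrefl _)

theorem IsTail.isNCL_blocks {f : Fin n → Finset (Fin n)} (hf : IsTail f) : IsNCL (blocks f) := by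
  have key : ∀ {C}, C ∈ blocks f → ∀ {D}, D ∈ blocks f → C ≠ D → ∃ i j, i ≠ j ∧
      (j ∈ f i → (f j).Nonempty) ∧ (i ∈ f j → (f i).Nonempty) ∧
      C = insert i (f i) ∧ D = insert j (f j) := by
    intro C hC D hD hne
    obtain ⟨i, hi, rfl⟩ := mem_blocks.1 hC
    obtain ⟨j, hj, rfl⟩ := mem_blocks.1 hD
    refine ⟨i, j, ?_, fun h => hj.resolve_right fun h' => h' i h,
      fun h => hi.resolve_right fun h' => h' j h, rfl, rfl⟩
    rintro rfl
    exact hne rfl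
  have hcard : ∀ {i : Fin n}, (f i).Nonempty → 2 ≤ (insert i (f i)).card := by
    intro i hi
    rw [card_insert_of_notMem fun h => lt_irrefl _ (hf.lt i i h)]
    have := hi.card_pos
    omega
  refine ⟨?_, ?_, ?_, ?_, ?_⟩
  · intro C hC
    obtain ⟨i, _, rfl⟩ := mem_blocks.1 hC
    exact insert_nonempty _ _
  · intro i
    by_cases h : ∃ j, i ∈ f j
    · obtain ⟨j, hj⟩ := h
      exact ⟨_, mem_blocks.2 ⟨j, Or.inl ⟨i, hj⟩, rfl⟩, mem_insert_of_mem hj⟩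
    · push Not at h
      exact ⟨_, mem_blocks.2 ⟨i, Or.inr h, rfl⟩, mem_insert_self _ _⟩
  · rintro C hC D hD hne a ha b hb c hc d hd ⟨hab, hbc, hcd⟩
    obtain ⟨i, j, hij, _, _, rfl, rfl⟩ := key hC hD hne
    have hi : i ≤ a := (hf.isMinOf.2 rfl : IsMinOf i _).2 a ha
    have hj : j ≤ b := (hf.isMinOf.2 rfl : IsMinOf j _).2 b hb
    have hc' : c ∈ f i := (mem_insert.1 hc).resolve_left (by omega)
    have hd' : d ∈ f j := (mem_insert.1 hd).resolve_left (by omega)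
    rcases lt_or_gt_of_ne hij with h | h
    · have := hf.nested i j c d h hc' hd' (by omega)
      omega
    · have hb' : b ∈ f j := (mem_insert.1 hb).resolve_left (by omega)
      have := hf.nested j i b c h hb' hc' (by omega)
      omega
  · intro C hC D hD hne
    obtain ⟨i, j, hij, _, _, rfl, rfl⟩ := key hC hD hne
    rw [card_le_one]
    intro a ha b hb
    rcases lt_or_gt_of_ne hij with h | h
    · rw [(hf.eq_of_mem_inter h ha).1, (hf.eq_of_mem_inter h hb).1]
    · rw [inter_comm] at ha hb
      rw [(hf.eq_of_mem_inter h ha).1, (hf.eq_of_mem_inter h hb).1]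
  · intro C hC D hD hne x hx
    obtain ⟨i, j, hij, hj, hi, rfl, rfl⟩ := key hC hD hne
    rw [hf.isMinOf, hf.isMinOf]
    rcases lt_or_gt_of_ne hij with h | h
    · obtain ⟨rfl, hm⟩ := hf.eq_of_mem_inter h hx
      exact ⟨hcard ⟨_, hm⟩, hcard (hj hm), Or.inr ⟨rfl, hij.symm⟩⟩
    · rw [inter_comm] at hx
      obtain ⟨rfl, hm⟩ := hf.eq_of_mem_inter h hx
      exact ⟨hcard (hi hm), hcard ⟨_, hm⟩, Or.inl ⟨rfl, hij⟩⟩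

open scoped Classical in
/-- Summation over `NCL(n)` is summation over families of tails. -/
theorem sum_NCL_eq_sum_isTail {M : Type*} [AddCommMonoid M]
    (F : Finset (Finset (Fin n)) → M) (G : (Fin n → Finset (Fin n)) → M)
    (h : ∀ π, IsNCL π → F π = G (tails π)) :
    ∑ π ∈ NCL n, F π = ∑ f : Fin n → Finset (Fin n) with IsTail f, G f := by
  refine Finset.sum_bij' (fun π _ => tails π) (fun f _ => blocks f) ?_ ?_ ?_ ?_ ?_
  · intro π hπ
    simpa using (mem_NCL.1 hπ).isTail
  · intro f hf
    exact mem_NCL.2 (by simpa using hf : IsTail f).isNCL_blocks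
  · intro π hπ
    exact (mem_NCL.1 hπ).blocks_tails
  · intro f hf
    exact (by simpa using hf : IsTail f).tails_blocks
  · intro π hπ
    exact h π (mem_NCL.1 hπ)

end Tails

/-! ### The weight of a partition in terms of its tails -/

section Weights

variable {n : ℕ} {B : Type*} [Ring B]

theorem isInterior_iff_isCovered {π : Finset (Finset (Fin n))} {C : Finset (Fin n)}
    {i : Fin n} (hi : IsMinOf i C) : IsInterior π C ↔ IsCovered (tails π) i := by
  constructor
  · rintro ⟨D, hD, l, hl, s, hs, i', hi', hli, his⟩
    obtain rfl := hi.unique hi'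
    obtain ⟨j, hj⟩ := CFreeness.exists_isMinOf ⟨l, hl⟩
    have hjl := hj.2 l hl
    exact ⟨j, by omega, s, mem_tails.2 ⟨by omega, D, hD, hj, hs⟩, his⟩
  · rintro ⟨j, hji, p, hp, hip⟩
    obtain ⟨_, D, hD, hj, hpD⟩ := mem_tails.1 hp
    exact ⟨D, hD, j, hj.1, p, hpD, i, hi, hji, hip⟩

theorem mem_nonMinima {π : Finset (Finset (Fin n))} {p : Fin n} :
    p ∈ nonMinima π ↔ ∀ C ∈ π, ¬ IsMinOf p C := by
  simp [nonMinima]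

theorem mem_intBlocks {π : Finset (Finset (Fin n))} {C : Finset (Fin n)} :
    C ∈ intBlocks π ↔ C ∈ π ∧ IsInterior π C := by
  simp [intBlocks]

theorem mem_extBlocks {π : Finset (Finset (Fin n))} {C : Finset (Fin n)} :
    C ∈ extBlocks π ↔ C ∈ π ∧ ¬ IsInterior π C := by
  simp [extBlocks]

theorem tails_of_mem_nonMinima {π : Finset (Finset (Fin n))} {p : Fin n} (hp : p ∈ nonMinima π) :
    tails π p = ∅ := by
  ext q
  simp only [mem_tails, notMem_empty, iff_false]
  rintro ⟨_, C, hC, h, _⟩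
  exact mem_nonMinima.1 hp C hC h

open scoped Classical in
/-- An interior block contributes through its minimal element, and an element that is not minimal
through its one-element tail, so that together they run over all covered positions. -/
theorem IsNCL.prod_intBlocks {π : Finset (Finset (Fin n))} (hπ : IsNCL π)
    (τ : Finset (Fin n) → ℂ) :
    (∏ D ∈ intBlocks π, τ D) * ∏ p ∈ nonMinima π, τ {p} =
      ∏ i with IsCovered (tails π) i, τ (insert i (tails π i)) := by
  rw [← Finset.prod_filter_mul_prod_filter_not (univ.filter fun i => IsCovered (tails π) i)
    (fun i => ∃ C ∈ π, IsMinOf i C)]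
  congr 1
  · symm
    refine Finset.prod_bij (fun i _ => insert i (tails π i)) ?_ ?_ ?_ (fun _ _ => rfl)
    · intro i hi
      obtain ⟨h1, C, hC, hiC⟩ := by simpa using hi
      rw [hπ.insert_tails hC hiC]
      exact mem_intBlocks.2 ⟨hC, (isInterior_iff_isCovered hiC).2 h1⟩
    · intro i _ j _ h
      exact (hπ.isTail.isMinOf.2 rfl : IsMinOf i _).unique (h ▸ hπ.isTail.isMinOf.2 rfl)
    · intro C hC
      obtain ⟨hC, hint⟩ := mem_intBlocks.1 hC
      obtain ⟨i, hi⟩ := CFreeness.exists_isMinOf (hπ.nonempty C hC)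
      refine ⟨i, ?_, hπ.insert_tails hC hi⟩
      simpa using ⟨(isInterior_iff_isCovered hi).1 hint, C, hC, hi⟩
  · have : nonMinima π = (univ.filter fun i => IsCovered (tails π) i).filter
        fun i => ¬ ∃ C ∈ π, IsMinOf i C := by
      ext p
      simp only [mem_nonMinima, mem_filter, mem_univ, true_and, not_exists, not_and]
      refine ⟨fun h => ⟨?_, h⟩, fun h => h.2⟩
      by_contra hc
      obtain ⟨C, hC, hp⟩ := hπ.exists_isMinOf (i := p) fun j hj =>
        hc ⟨j, hπ.isTail.lt _ _ hj, p, hj, le_rfl⟩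
      exact h C hC hp
    rw [← this]
    refine Finset.prod_congr rfl fun p hp => ?_
    rw [tails_of_mem_nonMinima hp]
    rfl

open scoped Classical in
theorem IsNCL.prod_extList {π : Finset (Finset (Fin n))} (hπ : IsNCL π)
    (κ : Finset (Fin n) → B) :
    ((extList π).map κ).prod = ((List.finRange n).map fun i =>
      if IsCovered (tails π) i then 1 else κ (insert i (tails π i))).prod := by
  rw [extList, List.map_flatMap, List.flatMap_def, List.prod_flatten, List.map_map]
  congr 2
  funext i
  simp only [Function.comp]
  by_cases h : IsCovered (tails π) i
  · rw [if_pos h]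
    have : (extBlocks π).filter (fun C => IsMinOf i C) = ∅ := by
      refine Finset.filter_eq_empty_iff.2 fun C hC hi => ?_
      exact (mem_extBlocks.1 hC).2 ((isInterior_iff_isCovered hi).2 h)
    simp [this]
  · rw [if_neg h]
    obtain ⟨C, hC, hi⟩ := hπ.exists_isMinOf (i := i) fun j hj =>
      h ⟨j, hπ.isTail.lt _ _ hj, i, hj, le_rfl⟩
    have : (extBlocks π).filter (fun C => IsMinOf i C) = {insert i (tails π i)} := by
      rw [hπ.insert_tails hC hi]
      ext D
      simp only [mem_filter, mem_singleton, mem_extBlocks]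
      constructor
      · rintro ⟨⟨hD, _⟩, hiD⟩
        exact hπ.eq_of_isMinOf hD hC hiD hi
      · rintro rfl
        exact ⟨⟨hC, fun h' => h ((isInterior_iff_isCovered hi).1 h')⟩, hi⟩
    simp [this]

open scoped Classical in
/-- The scalar factors of a product may be collected in front. -/
theorem prod_smul_list_prod [Algebra ℂ B] {ι : Type*} (L : List ι) (P : ι → Prop) (z : ι → ℂ) (b : ι → B) :
    (L.map fun i => if P i then z i else 1).prod • (L.map fun i => if P i then 1 else b i).prod =
      (L.map fun i => if P i then algebraMap ℂ B (z i) else b i).prod := by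
  induction L with
  | nil => simp
  | cons i L ih =>
    simp only [List.map_cons, List.prod_cons, ← ih]
    by_cases h : P i
    · simp [h, Algebra.smul_def, mul_assoc]
    · simp [h]

open scoped Classical in
/-- The weight of a family of tails relative to a set `S` of elements that still wait for the
minimal element of the block they are in: such an element covers everything to its left. The product
runs over the positions in `L`. -/
noncomputable def tailWeight [Algebra ℂ B] (τ : Finset (Fin n) → ℂ) (κ : Finset (Fin n) → B)
    (L : List (Fin n)) (S : Finset (Fin n)) (f : Fin n → Finset (Fin n)) : B :=
  (L.map fun i => if IsCovered f i ∨ ∃ s ∈ S, i ≤ s then algebraMap ℂ B (τ (insert i (f i)))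
    else κ (insert i (f i))).prod

open scoped Classical in
theorem sum_NCL_eq_sum_tailWeight [Algebra ℂ B] (τ : Finset (Fin n) → ℂ) (κ : Finset (Fin n) → B) :
    ∑ π ∈ NCL n, ((∏ D ∈ intBlocks π, τ D) * ∏ p ∈ nonMinima π, τ {p}) •
        ((extList π).map κ).prod =
      ∑ f : Fin n → Finset (Fin n) with IsTail f, tailWeight τ κ (List.finRange n) ∅ f := by
  refine sum_NCL_eq_sum_isTail _ _ fun π hπ => ?_
  rw [hπ.prod_intBlocks, hπ.prod_extList, Finset.prod_filter, tailWeight]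
  simp only [notMem_empty, false_and, exists_false, or_false]
  rw [← prod_smul_list_prod, ← List.prod_ofFn, List.ofFn_eq_map]

open scoped Classical in
/-- For scalar weights that do not distinguish interior and exterior blocks the weight of a
partition is the product over all its blocks. -/
theorem IsNCL.prod_eq (τ : Finset (Fin n) → ℂ) {π : Finset (Finset (Fin n))} (hπ : IsNCL π) :
    (∏ D ∈ intBlocks π, τ D) * ((extList π).map τ).prod = ∏ C ∈ π, τ C := by
  have hext : ((extList π).map τ).prod = ∏ C ∈ extBlocks π, τ C := by
    rw [hπ.prod_extList, ← List.ofFn_eq_map, List.prod_ofFn]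
    have : ∀ i, (if IsCovered (tails π) i then 1 else τ (insert i (tails π i))) =
        if ¬ IsCovered (tails π) i then τ (insert i (tails π i)) else 1 := by
      intro i
      split_ifs <;> rfl
    simp only [this]
    rw [← Finset.prod_filter]
    refine Finset.prod_bij (fun i _ => insert i (tails π i)) ?_ ?_ ?_ (fun _ _ => rfl)
    · intro i hi
      have h : ¬ IsCovered (tails π) i := by simpa using hi
      obtain ⟨C, hC, hi⟩ := hπ.exists_isMinOf (i := i) fun j hj =>
        h ⟨j, hπ.isTail.lt _ _ hj, i, hj, le_rfl⟩
      rw [hπ.insert_tails hC hi]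
      exact mem_extBlocks.2 ⟨hC, fun h' => h ((isInterior_iff_isCovered hi).1 h')⟩
    · intro i _ j _ h
      exact (hπ.isTail.isMinOf.2 rfl : IsMinOf i _).unique (h ▸ hπ.isTail.isMinOf.2 rfl)
    · intro C hC
      obtain ⟨hC, hint⟩ := mem_extBlocks.1 hC
      obtain ⟨i, hi⟩ := CFreeness.exists_isMinOf (hπ.nonempty C hC)
      refine ⟨i, ?_, hπ.insert_tails hC hi⟩
      simpa using fun h => hint ((isInterior_iff_isCovered hi).2 h)
  rw [hext]
  exact Finset.prod_filter_mul_prod_filter_not _ _ _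

end Weights

/-! ### Families of tails with open elements -/

section OpenTails

variable {n : ℕ}

open scoped Classical in
/-- The families of tails of the positions `≥ k` for which all elements of `S` may still be put into
a tail of a position `< k`: no arc covers an element of `S`. -/
noncomputable def openTails (k : ℕ) (S : Finset (Fin n)) : Finset (Fin n → Finset (Fin n)) :=
  univ.filter fun f => IsTail f ∧ (∀ i : Fin n, i.val < k → f i = ∅) ∧
    ∀ j ∈ S, ∀ i, i < j → ∀ p ∈ f i, p < j

theorem mem_openTails {k : ℕ} {S : Finset (Fin n)} {f : Fin n → Finset (Fin n)} :
    f ∈ openTails k S ↔ IsTail f ∧ (∀ i : Fin n, i.val < k → f i = ∅) ∧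
      ∀ j ∈ S, ∀ i, i < j → ∀ p ∈ f i, p < j := by
  simp [openTails]

open scoped Classical in
/-- The possible tails of `k`, if the elements of `v` stay open. -/
noncomputable def tailsBelow (k : Fin n) (v : Finset (Fin n)) : Finset (Finset (Fin n)) :=
  univ.filter fun u => ∀ i ∈ u, k < i ∧ ∀ j ∈ v, i < j

theorem mem_tailsBelow {k : Fin n} {u v : Finset (Fin n)} :
    u ∈ tailsBelow k v ↔ ∀ i ∈ u, k < i ∧ ∀ j ∈ v, i < j := by
  simp [tailsBelow]

/-- A family of tails of the positions `≥ k` consists of a tail `u` of `k` and of a family of tails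
of the positions `> k`, for which the elements of `u` are open. -/
theorem mem_openTails_iff {k : Fin n} {S v : Finset (Fin n)} (hv : ∀ j ∈ v, k < j)
    (hS : S = v ∨ S = insert k v) {f : Fin n → Finset (Fin n)} :
    f ∈ openTails k S ↔
      f k ∈ tailsBelow k v ∧ Function.update f k ∅ ∈ openTails (k + 1) (f k ∪ v) := by
  have hne : ∀ {i p}, p ∈ Function.update f k ∅ i ↔ i ≠ k ∧ p ∈ f i := by
    intro i p
    by_cases h : i = k
    · subst h; simp
    · simp [h]
  have hSv : ∀ j, j ∈ S → j = k ∨ j ∈ v := by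
    rcases hS with rfl | rfl
    · exact fun j => Or.inr
    · exact fun j => by simp
  have hvS : ∀ j ∈ v, j ∈ S := by
    rcases hS with rfl | rfl
    · exact fun j => id
    · exact fun j => by simp +contextual
  rw [mem_openTails, mem_openTails, mem_tailsBelow]
  constructor
  · rintro ⟨hf, h0, hop⟩
    refine ⟨fun i hi => ⟨hf.lt k i hi, fun j hj => hop j (hvS j hj) k (hv j hj) i hi⟩,
      ⟨fun i p hp => hf.lt i p (hne.1 hp).2, fun i j p q hij hp hq hjp =>
        hf.nested i j p q hij (hne.1 hp).2 (hne.1 hq).2 hjp⟩, fun i hi => ?_,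
      fun j hj i hij p hp => ?_⟩
    · rcases (Nat.lt_succ_iff.1 hi).eq_or_lt with h | h
      · rw [Fin.ext h, Function.update_self]
      · rw [Function.update_of_ne (by rintro rfl; omega), h0 i h]
    · obtain ⟨hik, hp⟩ := hne.1 hp
      rcases mem_union.1 hj with hj | hj
      · rcases lt_or_gt_of_ne hik with h | h
        · simp [h0 i h] at hp
        · exact hf.nested k i j p h hj hp hij
      · exact hop j (hvS j hj) i hij p hp
  · rintro ⟨hu, ⟨hlt, hnest⟩, h0, hop⟩
    have h0' : ∀ i : Fin n, i < k → f i = ∅ := by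
      intro i hi
      have := h0 i (by omega)
      rwa [Function.update_of_ne hi.ne] at this
    refine ⟨⟨fun i p hp => ?_, fun i j p q hij hp hq hjp => ?_⟩, h0', fun j hj i hij p hp => ?_⟩
    · by_cases hi : i = k
      · subst hi
        exact (hu p hp).1
      · exact hlt i p (hne.2 ⟨hi, hp⟩)
    · have hik : k ≤ i := by
        by_contra h
        simp [h0' i (not_le.1 h)] at hp
      rcases hik.eq_or_lt with rfl | hik
      · exact hop p (mem_union_left _ hp) j hjp q (hne.2 ⟨hij.ne', hq⟩)
      · exact hnest i j p q hij (hne.2 ⟨hik.ne', hp⟩) (hne.2 ⟨(hik.trans hij).ne', hq⟩) hjp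
    · have hik : k ≤ i := by
        by_contra h
        simp [h0' i (not_le.1 h)] at hp
      have hjv : j ∈ v := (hSv j hj).resolve_left (by omega)
      rcases hik.eq_or_lt with rfl | hik
      · exact (hu p hp).2 j hjv
      · exact hop j (mem_union_right _ hjv) i hij p (hne.2 ⟨hik.ne', hp⟩)

variable {B : Type*} [Ring B] [Algebra ℂ B] (τ : Finset (Fin n) → ℂ) (κ : Finset (Fin n) → B)

/-- The factor that a block `C` contributes: `κ C` if it is exterior, and the scalar `t C` otherwise.
When positions are read from the right, a block is exterior if and only if nothing is open once its
minimal element has been read. -/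
noncomputable def blockCoeff {ι : Type*} (t : ι → ℂ) (κ : ι → B) (C : ι) (ext : Prop)
    [Decidable ext] : B :=
  if ext then κ C else algebraMap ℂ B (t C)

/-- The sum of the weights of all families of tails of the positions `≥ k` with open elements
`S`. -/
noncomputable def openSum (k : ℕ) (S : Finset (Fin n)) : B :=
  ∑ f ∈ openTails k S, tailWeight τ κ ((List.finRange n).drop k) S f

theorem finRange_drop (k : Fin n) :
    (List.finRange n).drop k = k :: (List.finRange n).drop (k + 1) := by
  rw [List.drop_eq_getElem_cons (by simp)]
  simp

theorem lt_of_mem_drop {k i : Fin n} (hi : i ∈ (List.finRange n).drop (k + 1)) : k < i := by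
  obtain ⟨j, hj, rfl⟩ := List.mem_drop_iff_getElem.1 hi
  simp only [List.getElem_finRange, Fin.lt_def, Fin.val_cast]
  omega

theorem tailWeight_step {k : Fin n} {S v : Finset (Fin n)} (hv : ∀ j ∈ v, k < j)
    (hS : S = v ∨ S = insert k v) {f : Fin n → Finset (Fin n)} (h0 : ∀ i, i < k → f i = ∅) :
    tailWeight τ κ ((List.finRange n).drop k) S f =
      blockCoeff τ κ (insert k (f k)) (S = ∅) *
        tailWeight τ κ ((List.finRange n).drop (k + 1)) (f k ∪ v) (Function.update f k ∅) := by
  classical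
  have hkS : (∃ s ∈ S, k ≤ s) ↔ ¬ S = ∅ := by
    rw [← ne_eq, ← nonempty_iff_ne_empty]
    constructor
    · rintro ⟨s, hs, _⟩
      exact ⟨s, hs⟩
    · rintro ⟨s, hs⟩
      refine ⟨s, hs, ?_⟩
      rcases hS with rfl | rfl
      · exact (hv s hs).le
      · rcases mem_insert.1 hs with rfl | hs
        · exact le_rfl
        · exact (hv s hs).le
  have hcov : ¬ IsCovered f k := by
    rintro ⟨j, hj, p, hp, _⟩
    simp [h0 j hj] at hp
  rw [tailWeight, tailWeight, finRange_drop, List.map_cons, List.prod_cons]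
  congr 1
  · by_cases h : S = ∅
    · simp [blockCoeff, hcov, h]
    · rw [if_pos (Or.inr (hkS.2 h)), blockCoeff, if_neg h]
  · congr 1
    refine List.map_congr_left fun i hi => ?_
    have hki := lt_of_mem_drop hi
    rw [Function.update_of_ne hki.ne']
    have : (IsCovered f i ∨ ∃ s ∈ S, i ≤ s) ↔
        (IsCovered (Function.update f k ∅) i ∨ ∃ s ∈ f k ∪ v, i ≤ s) := by
      constructor
      · rintro (⟨j, hj, p, hp, hip⟩ | ⟨s, hs, his⟩)
        · by_cases hjk : j = k
          · subst hjk
            exact Or.inr ⟨p, mem_union_left _ hp, hip⟩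
          · exact Or.inl ⟨j, hj, p, by rwa [Function.update_of_ne hjk], hip⟩
        · refine Or.inr ⟨s, mem_union_right _ ?_, his⟩
          rcases hS with rfl | rfl
          · exact hs
          · exact (mem_insert.1 hs).resolve_left (by omega)
      · rintro (⟨j, hj, p, hp, hip⟩ | ⟨s, hs, his⟩)
        · by_cases hjk : j = k
          · subst hjk
            simp at hp
          · exact Or.inl ⟨j, hj, p, by rwa [Function.update_of_ne hjk] at hp, hip⟩
        · rcases mem_union.1 hs with hs | hs
          · exact Or.inl ⟨k, hki, s, hs, his⟩
          · refine Or.inr ⟨s, ?_, his⟩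
            rcases hS with rfl | rfl
            · exact hs
            · exact mem_insert_of_mem hs
    simp only [this]

/-- The recursion for `openSum`: the position `k` closes a block `insert k u`, and is itself open if
`k ∈ S`. -/
theorem openSum_step {k : Fin n} {S v : Finset (Fin n)} (hv : ∀ j ∈ v, k < j)
    (hS : S = v ∨ S = insert k v) :
    openSum τ κ k S = ∑ u ∈ tailsBelow k v,
      blockCoeff τ κ (insert k u) (S = ∅) * openSum τ κ (k + 1) (u ∪ v) := by
  classical
  simp only [openSum, Finset.mul_sum]
  rw [Finset.sum_sigma']
  have hupd : ∀ (u : Finset (Fin n)) (g : Fin n → Finset (Fin n)),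
      g ∈ openTails (k + 1) (u ∪ v) → Function.update (Function.update g k u) k ∅ = g := by
    intro u g hg
    rw [Function.update_idem, ← (mem_openTails.1 hg).2.1 k (Nat.lt_succ_self _),
      Function.update_eq_self]
  refine Finset.sum_bij' (fun f _ => ⟨f k, Function.update f k ∅⟩)
    (fun x _ => Function.update x.2 k x.1) ?_ ?_ ?_ ?_ ?_
  · intro f hf
    exact mem_sigma.2 ((mem_openTails_iff hv hS).1 hf)
  · rintro ⟨u, g⟩ hx
    obtain ⟨hu, hg⟩ := mem_sigma.1 hx
    rw [mem_openTails_iff hv hS]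
    dsimp only at hu hg ⊢
    rw [hupd u g hg, Function.update_self]
    exact ⟨hu, hg⟩
  · intro f hf
    simp
  · rintro ⟨u, g⟩ hx
    obtain ⟨hu, hg⟩ := mem_sigma.1 hx
    dsimp only at hu hg ⊢
    rw [hupd u g hg, Function.update_self]
  · intro f hf
    exact tailWeight_step τ κ hv hS fun i hi => (mem_openTails.1 hf).2.1 i hi

theorem openSum_top : openSum τ κ n ∅ = 1 := by
  have : openTails n (∅ : Finset (Fin n)) = {fun _ => ∅} := by
    ext f
    rw [mem_openTails, mem_singleton]
    constructor
    · rintro ⟨_, h, _⟩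
      exact funext fun i => h i i.isLt
    · rintro rfl
      exact ⟨⟨by simp, by simp⟩, by simp, by simp⟩
  rw [openSum, this, sum_singleton, tailWeight, List.drop_eq_nil_of_le (by simp)]
  rfl

theorem openSum_zero : openSum τ κ 0 ∅ = ∑ π ∈ NCL n,
    ((∏ D ∈ intBlocks π, τ D) * ∏ p ∈ nonMinima π, τ {p}) • ((extList π).map κ).prod := by
  rw [sum_NCL_eq_sum_tailWeight, openSum, List.drop_zero]
  refine Finset.sum_congr ?_ fun _ _ => rfl
  ext f
  simp [mem_openTails]

end OpenTails

/-! ### The stack operators -/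

section Stack

variable {α B : Type*} [Ring B] [Algebra ℂ B] (t : List α → ℂ) (κ : List α → B)

open scoped Classical in
/-- The stack operator of the letter `a` on the free `B`-module over the words in `α`: it removes a
prefix `u` from a word and multiplies with `t (a :: u)`, or with `κ (a :: u)` if nothing is left,
and then pushes `a` or not. If it pushes, the block `a :: u` is interior, and the factor is always
`t (a :: u)`. -/
noncomputable def stackOp (a : α) : (List α →₀ B) →ₗ[ℂ] (List α →₀ B) :=
  Finsupp.lsum ℂ fun s => ∑ i ∈ range (s.length + 1),
    (Finsupp.lsingle (s.drop i) ∘ₗ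
        LinearMap.mulLeft ℂ (blockCoeff t κ (a :: s.take i) (s.drop i = [])) +
      Finsupp.lsingle (a :: s.drop i) ∘ₗ
        LinearMap.mulLeft ℂ (blockCoeff t κ (a :: s.take i) False))

open scoped Classical in
theorem stackOp_single (a : α) (s : List α) (b : B) :
    stackOp t κ a (Finsupp.single s b) = ∑ i ∈ range (s.length + 1),
      (Finsupp.single (s.drop i) (blockCoeff t κ (a :: s.take i) (s.drop i = []) * b) +
        Finsupp.single (a :: s.drop i) (blockCoeff t κ (a :: s.take i) False * b)) := by
  simp [stackOp]

/-- The letters at the positions in `S`. -/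
noncomputable def subword {n : ℕ} (c : Fin n → α) (S : Finset (Fin n)) : List α :=
  S.sort.map c

variable {n : ℕ} (c : Fin n → α)

theorem subword_insert {k : Fin n} {u : Finset (Fin n)} (hu : ∀ i ∈ u, k < i) :
    subword c (insert k u) = c k :: subword c u := by
  rw [subword, subword, Finset.sort_insert (· ≤ ·) (fun i hi => (hu i hi).le)
    fun h => lt_irrefl _ (hu k h), List.map_cons]

theorem sort_union {u v : Finset (Fin n)} (h : ∀ i ∈ u, ∀ j ∈ v, i < j) :
    (u ∪ v).sort = u.sort ++ v.sort := by
  refine (u ∪ v).sortedLT_sort.eq_of_mem_iff ?_ (by simp)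
  rw [List.sortedLT_iff_pairwise, List.pairwise_append]
  refine ⟨u.sortedLT_sort.pairwise, v.sortedLT_sort.pairwise, ?_⟩
  simpa using h

open scoped Classical in
/-- The ways to write a finite set as a union of an initial and a final segment. -/
theorem sum_splits {M : Type*} [AddCommMonoid M] (S : Finset (Fin n))
    (F : List α → List α → M) :
    ∑ i ∈ range ((subword c S).length + 1), F ((subword c S).take i) ((subword c S).drop i) =
      ∑ x : Finset (Fin n) × Finset (Fin n) with (∀ i ∈ x.1, ∀ j ∈ x.2, i < j) ∧ x.1 ∪ x.2 = S,
        F (subword c x.1) (subword c x.2) := by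
  have hpw : ∀ i, ∀ a ∈ S.sort.take i, ∀ b ∈ S.sort.drop i, a < b := by
    intro i
    have := S.sortedLT_sort.pairwise
    rw [← List.take_append_drop i (S.sort (· ≤ ·)), List.pairwise_append] at this
    exact this.2.2
  have hsort : ∀ l : List (Fin n), l.Pairwise (· < ·) → l.toFinset.sort = l := fun l hl =>
    (Finset.sortedLT_sort _).eq_of_mem_iff hl.sortedLT (by simp)
  have htake : ∀ i, (S.sort.take i).toFinset.sort = S.sort.take i := fun i =>
    hsort _ (S.sortedLT_sort.pairwise.sublist (List.take_sublist _ _))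
  have hdrop : ∀ i, (S.sort.drop i).toFinset.sort = S.sort.drop i := fun i =>
    hsort _ (S.sortedLT_sort.pairwise.sublist (List.drop_sublist _ _))
  refine Finset.sum_bij' (fun i _ => ((S.sort.take i).toFinset, (S.sort.drop i).toFinset))
    (fun x _ => x.1.card) ?_ ?_ ?_ ?_ ?_
  · intro i _
    simp only [mem_filter, mem_univ, true_and, List.mem_toFinset]
    refine ⟨hpw i, ?_⟩
    rw [← List.toFinset_append, List.take_append_drop, Finset.sort_toFinset]
  · rintro ⟨u, v⟩ hx
    simp only [mem_filter, mem_univ, true_and] at hx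
    simp only [subword, List.length_map, Finset.length_sort, mem_range]
    have := Finset.card_le_card (hx.2 ▸ subset_union_left : u ⊆ S)
    omega
  · intro i hi
    simp only [subword, List.length_map, Finset.length_sort, mem_range] at hi
    rw [← Finset.length_sort (· ≤ ·), htake, List.length_take, Finset.length_sort]
    omega
  · rintro ⟨u, v⟩ hx
    simp only [mem_filter, mem_univ, true_and] at hx
    obtain ⟨h, rfl⟩ := hx
    have hlen : u.card = u.sort.length := (Finset.length_sort _).symm
    dsimp only
    rw [sort_union h, hlen, List.take_left, List.drop_left, Finset.sort_toFinset,
      Finset.sort_toFinset]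
  · intro i _
    simp only [subword, htake, hdrop, List.map_take, List.map_drop]

/-- The state of the stack after the letters at the positions `≥ k` have been read from the right:
every set of open positions contributes the word that it spells. -/
noncomputable def stackState (k : ℕ) : List α →₀ B :=
  ∑ S ∈ (univ.filter fun j : Fin n => k ≤ j.val).powerset,
    Finsupp.single (subword c S)
      (openSum (fun C => t (subword c C)) (fun C => κ (subword c C)) k S)

theorem subword_eq_nil {S : Finset (Fin n)} : subword c S = [] ↔ S = ∅ := by
  rw [subword, List.map_eq_nil_iff, ← List.length_eq_zero_iff, Finset.length_sort, card_eq_zero]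

theorem stackState_step (k : Fin n) :
    stackState t κ c k = stackOp t κ (c k) (stackState t κ c (k + 1)) := by
  classical
  set V : ℕ → Finset (Fin n) → B :=
    openSum (fun C => t (subword c C)) (fun C => κ (subword c C)) with hV
  set I : Finset (Fin n) := univ.filter fun j : Fin n => k + 1 ≤ j.val with hI
  have hmemI : ∀ j, j ∈ I ↔ k < j := by
    intro j
    simp only [hI, mem_filter, mem_univ, true_and]
    exact Iff.rfl
  let G : Finset (Fin n) → Finset (Fin n) → (List α →₀ B) := fun u v =>
    Finsupp.single (subword c v)
        (blockCoeff t κ (c k :: subword c u) (subword c v = []) * V (k + 1) (u ∪ v)) +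
      Finsupp.single (c k :: subword c v)
        (blockCoeff t κ (c k :: subword c u) False * V (k + 1) (u ∪ v))
  have hins : (univ.filter fun j : Fin n => k.val ≤ j.val) = insert k I := by
    ext j
    rw [mem_insert, hmemI]
    simp only [mem_filter, mem_univ, true_and]
    omega
  have hL : stackState t κ c k = ∑ v ∈ I.powerset, ∑ u ∈ tailsBelow k v, G u v := by
    rw [stackState, hins, Finset.sum_powerset_insert (by simp [hmemI]),
      ← Finset.sum_add_distrib]
    refine Finset.sum_congr rfl fun v hv => ?_
    have hv : ∀ j ∈ v, k < j := fun j hj => (hmemI j).1 (mem_powerset.1 hv hj)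
    rw [openSum_step _ _ hv (Or.inl rfl), openSum_step _ _ hv (Or.inr rfl), subword_insert c hv]
    simp only [Finsupp.single_finsetSum, ← Finset.sum_add_distrib]
    refine Finset.sum_congr rfl fun u hu => ?_
    have hu : ∀ j ∈ u, k < j := fun j hj => (mem_tailsBelow.1 hu j hj).1
    simp only [blockCoeff, subword_insert c hu, subword_eq_nil, insert_ne_empty, G, hV]
  have hR : stackOp t κ (c k) (stackState t κ c (k + 1)) =
      ∑ S ∈ I.powerset, ∑ x : Finset (Fin n) × Finset (Fin n) with
        (∀ i ∈ x.1, ∀ j ∈ x.2, i < j) ∧ x.1 ∪ x.2 = S, G x.1 x.2 := by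
    rw [stackState, map_sum]
    refine Finset.sum_congr rfl fun S _ => ?_
    rw [stackOp_single, sum_splits c S (fun p q =>
      Finsupp.single q (blockCoeff t κ (c k :: p) (q = []) * V (k + 1) S) +
      Finsupp.single (c k :: q) (blockCoeff t κ (c k :: p) False * V (k + 1) S))]
    refine Finset.sum_congr rfl fun x hx => ?_
    rw [← (mem_filter.1 hx).2.2]
  rw [hL, hR, Finset.sum_sigma', Finset.sum_sigma']
  refine Finset.sum_bij' (fun x _ => ⟨x.2 ∪ x.1, (x.2, x.1)⟩) (fun x _ => ⟨x.2.2, x.2.1⟩)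
    ?_ ?_ ?_ ?_ ?_
  · rintro ⟨v, u⟩ hx
    simp only [mem_sigma, mem_powerset, mem_tailsBelow, subset_iff, hmemI] at hx
    simp only [mem_sigma, mem_powerset, mem_filter, mem_univ, true_and, subset_iff, hmemI,
      mem_union, and_true]
    exact ⟨fun j hj => hj.elim (fun h => (hx.2 j h).1) fun h => hx.1 h, fun i hi => (hx.2 i hi).2⟩
  · rintro ⟨S, u, v⟩ hx
    simp only [mem_sigma, mem_powerset, mem_filter, mem_univ, true_and, subset_iff, hmemI] at hx
    obtain ⟨h1, h2, rfl⟩ := hx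
    simp only [mem_sigma, mem_powerset, mem_tailsBelow, subset_iff, hmemI]
    exact ⟨fun j hj => h1 (mem_union_right _ hj),
      fun i hi => ⟨h1 (mem_union_left _ hi), h2 i hi⟩⟩
  · rintro ⟨v, u⟩ _
    rfl
  · rintro ⟨S, u, v⟩ hx
    simp only [mem_sigma, mem_filter] at hx
    obtain ⟨_, _, _, rfl⟩ := hx
    rfl
  · rintro ⟨v, u⟩ _
    rfl

theorem stackState_top : stackState t κ c n = Finsupp.single [] 1 := by
  have : (univ.filter fun j : Fin n => n ≤ j.val) = ∅ :=
    Finset.filter_eq_empty_iff.2 fun j _ => not_le.2 j.isLt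
  rw [stackState, this, powerset_empty, sum_singleton, openSum_top, (subword_eq_nil c).2 rfl]

theorem stackState_eq (k : ℕ) (hk : k ≤ n) : stackState t κ c k =
    (((List.finRange n).drop k).map fun i => stackOp t κ (c i)).prod (Finsupp.single [] 1) := by
  induction hk using Nat.decreasingInduction with
  | self => rw [stackState_top, List.drop_eq_nil_of_le (by simp)]; rfl
  | of_succ k hk ih =>
    have h1 := stackState_step t κ c ⟨k, hk⟩
    have h2 := finRange_drop (⟨k, hk⟩ : Fin n)
    dsimp only at h1 h2
    rw [h1, h2, ih, List.map_cons, List.prod_cons, Module.End.mul_apply]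

/-- The vacuum expectation of a product of stack operators is a sum over non-crossing linked
partitions. -/
theorem stackOp_prod_apply_nil :
    (oprod (fun i => stackOp t κ (c i)) (Finsupp.single [] 1)) [] = ∑ π ∈ NCL n,
      ((∏ D ∈ intBlocks π, t (subword c D)) * ∏ p ∈ nonMinima π, t [c p]) •
        ((extList π).map fun C => κ (subword c C)).prod := by
  have h := stackState_eq t κ c 0 (Nat.zero_le n)
  rw [List.drop_zero, ← List.ofFn_eq_map] at h
  rw [oprod, ← h, stackState, Finsupp.finsetSum_apply, Finset.sum_eq_single ∅]
  · rw [(subword_eq_nil c).2 rfl, Finsupp.single_eq_same, openSum_zero]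
    simp [subword]
  · intro S _ hS
    rw [Finsupp.single_eq_of_ne]
    rwa [ne_comm, ne_eq, subword_eq_nil]
  · simp

end Stack

/-! ### The stack model is c-free -/

section Model

variable {α B : Type*} [Ring B] [Algebra ℂ B]

/-- The representation of the free algebra by stack operators. -/
noncomputable def stackRep (t : List α → ℂ) (κ : List α → B) :
    FreeAlgebra ℂ α →ₐ[ℂ] Module.End ℂ (List α →₀ B) :=
  FreeAlgebra.lift ℂ (stackOp t κ)

/-- The vacuum expectation of the stack model. -/
noncomputable def vacuum (t : List α → ℂ) (κ : List α → B) : FreeAlgebra ℂ α →ₗ[ℂ] B :=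
  Finsupp.lapply [] ∘ₗ LinearMap.applyₗ (Finsupp.single [] 1) ∘ₗ (stackRep t κ).toLinearMap

theorem vacuum_apply (t : List α → ℂ) (κ : List α → B) (p : FreeAlgebra ℂ α) :
    vacuum t κ p = stackRep t κ p (Finsupp.single [] 1) [] := rfl

theorem vacuum_one (t : List α → ℂ) (κ : List α → B) : vacuum t κ 1 = 1 := by
  simp [vacuum_apply]

theorem stackRep_ι (t : List α → ℂ) (κ : List α → B) (a : α) :
    stackRep t κ (FreeAlgebra.ι ℂ a) = stackOp t κ a := by
  simp [stackRep]

/-- A linear map that intertwines two operators intertwines all their polynomials. -/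
theorem intertwine {P M N : Type*} [Semiring P] [Algebra ℂ P] [AddCommMonoid M] [Module ℂ M]
    [AddCommMonoid N] [Module ℂ N] (ρ : P →ₐ[ℂ] Module.End ℂ M) (σ : P →ₐ[ℂ] Module.End ℂ N)
    (T : M →ₗ[ℂ] N) (s : Set P) (h : ∀ x ∈ s, ∀ m, T (ρ x m) = σ x (T m)) {p : P}
    (hp : p ∈ Algebra.adjoin ℂ s) (m : M) : T (ρ p m) = σ p (T m) := by
  induction hp using Algebra.adjoin_induction generalizing m with
  | mem x hx => exact h x hx m
  | algebraMap r => simp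
  | add p q _ _ hp hq => simp [hp, hq]
  | mul p q _ _ hp hq => simp [hp, hq]

/-- A submodule that is invariant under an operator is invariant under its polynomials. -/
theorem adjoin_invariant {P M : Type*} [Semiring P] [Algebra ℂ P] [AddCommMonoid M] [Module ℂ M]
    (ρ : P →ₐ[ℂ] Module.End ℂ M) (N : Submodule ℂ M) (s : Set P)
    (h : ∀ x ∈ s, ∀ m ∈ N, ρ x m ∈ N) {p : P} (hp : p ∈ Algebra.adjoin ℂ s) {m : M}
    (hm : m ∈ N) : ρ p m ∈ N := by
  induction hp using Algebra.adjoin_induction generalizing m with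
  | mem x hx => exact h x hx m hm
  | algebraMap r => simpa using N.smul_mem r hm
  | add p q _ _ hp hq => simpa using N.add_mem (hp hm) (hq hm)
  | mul p q _ _ hp hq => simpa using hp (hq hm)

/-- The stack operators commute with the right multiplications by elements of `B`. -/
theorem stackRep_single_mul (t : List α → ℂ) (κ : List α → B) (p : FreeAlgebra ℂ α) (b : B) :
    stackRep t κ p (Finsupp.single [] b) [] = vacuum t κ p * b := by
  classical
  let R : (List α →₀ B) →ₗ[ℂ] (List α →₀ B) :=
    Finsupp.mapRange.linearMap (LinearMap.mulRight ℂ b)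
  have hR : ∀ (s : List α) (d : B), R (Finsupp.single s d) = Finsupp.single s (d * b) := by
    intro s d
    simp [R]
  have h := intertwine (stackRep t κ) (stackRep t κ) R (Set.range (FreeAlgebra.ι ℂ)) ?_
    (p := p) (by rw [FreeAlgebra.adjoin_range_ι]; trivial) (Finsupp.single [] 1)
  · rw [hR, one_mul] at h
    rw [← h, vacuum_apply]
    simp [R]
  · rintro _ ⟨a, rfl⟩ m
    rw [stackRep_ι]
    refine LinearMap.congr_fun (f := R ∘ₗ stackOp t κ a) (g := stackOp t κ a ∘ₗ R)
      (Finsupp.lhom_ext fun s d => ?_) m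
    simp only [LinearMap.comp_apply, hR, stackOp_single, map_sum, map_add, mul_assoc]

/-- The vectors that are supported on the powers of the letter `a`, the empty word included. -/
noncomputable def powerVectors (B : Type*) [Ring B] [Algebra ℂ B] (a : α) :
    Submodule ℂ (List α →₀ B) :=
  Finsupp.supported B ℂ {s | ∀ x ∈ s, x = a}

/-- The vectors that are supported on the words with first letter `a`. -/
noncomputable def headVectors (B : Type*) [Ring B] [Algebra ℂ B] (a : α) :
    Submodule ℂ (List α →₀ B) :=
  Finsupp.supported B ℂ {s | s.head? = some a}

theorem stackRep_mem_powerVectors (t : List α → ℂ) (κ : List α → B) {a : α}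
    {p : FreeAlgebra ℂ α} (hp : p ∈ Algebra.adjoin ℂ {FreeAlgebra.ι ℂ a}) (b : B) :
    stackRep t κ p (Finsupp.single [] b) ∈ powerVectors B a := by
  classical
  refine adjoin_invariant (stackRep t κ) (powerVectors B a) _ ?_ hp
    (Finsupp.single_mem_supported ℂ _ (by simp))
  rintro _ rfl m hm
  rw [stackRep_ι, ← m.sum_single, Finsupp.sum, map_sum]
  refine Submodule.sum_mem _ fun s hs => ?_
  have hs : ∀ x ∈ s, x = a := hm hs
  rw [stackOp_single]
  refine Submodule.sum_mem _ fun i _ => Submodule.add_mem _ ?_ ?_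
  · exact Finsupp.single_mem_supported ℂ _ fun x hx => hs x (List.mem_of_mem_drop hx)
  · refine Finsupp.single_mem_supported ℂ _ fun x hx => ?_
    rcases List.mem_cons.1 hx with h | h
    · exact h
    · exact hs x (List.mem_of_mem_drop h)

/-- A polynomial in the letter `a` maps the vacuum to its expectation, up to words that start
with `a`. -/
theorem stackRep_sub_mem_headVectors (t : List α → ℂ) (κ : List α → B) {a : α}
    {p : FreeAlgebra ℂ α} (hp : p ∈ Algebra.adjoin ℂ {FreeAlgebra.ι ℂ a}) (b : B) :
    stackRep t κ p (Finsupp.single [] b) - Finsupp.single [] (vacuum t κ p * b) ∈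
      headVectors B a := by
  classical
  intro s hs
  have h := Finsupp.mem_support_iff.1 hs
  rw [← stackRep_single_mul, Finsupp.sub_apply] at h
  cases s with
  | nil => simp at h
  | cons x s =>
    rw [Finsupp.single_eq_of_ne (by simp), sub_zero] at h
    have := stackRep_mem_powerVectors t κ hp b (Finsupp.mem_support_iff.2 h) x (by simp)
    simp [this]

/-- `t` vanishes on all words that contain different letters. -/
def IsPure {M : Type*} [Zero M] (t : List α → M) : Prop :=
  ∀ a l, (∃ x ∈ l, x ≠ a) → t (a :: l) = 0

/-- Below a word `s` that starts with another letter, a polynomial in the letter `a` acts as it does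
on the vacuum of the scalar model. -/
theorem stackRep_single_of_head_ne {t : List α → ℂ} {κ : List α → B} (ht : IsPure t)
    (hκ : IsPure κ) {a : α} {p : FreeAlgebra ℂ α}
    (hp : p ∈ Algebra.adjoin ℂ {FreeAlgebra.ι ℂ a}) {x : α} (hx : x ≠ a) (s : List α) (b : B) :
    stackRep t κ p (Finsupp.single (x :: s) b) =
      Finsupp.lsum ℂ (fun u => Finsupp.lsingle (u ++ x :: s) ∘ₗ LinearMap.toSpanSingleton ℂ B b)
        (stackRep t t p (Finsupp.single [] 1)) := by
  classical
  set T : (List α →₀ ℂ) →ₗ[ℂ] (List α →₀ B) :=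
    Finsupp.lsum ℂ fun u => Finsupp.lsingle (u ++ x :: s) ∘ₗ LinearMap.toSpanSingleton ℂ B b
    with hT
  have hTs : ∀ u z, T (Finsupp.single u z) = Finsupp.single (u ++ x :: s) (z • b) := by
    intro u z
    simp [hT]
  rw [intertwine (stackRep t t) (stackRep t κ) T {FreeAlgebra.ι ℂ a} ?_ hp, hTs]
  · simp
  rintro _ rfl m
  rw [stackRep_ι, stackRep_ι]
  refine LinearMap.congr_fun (f := T ∘ₗ stackOp t t a) (g := stackOp t κ a ∘ₗ T)
    (Finsupp.lhom_ext fun u z => ?_) m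
  simp only [LinearMap.comp_apply, hTs, stackOp_single, map_sum, map_add]
  -- The prefixes that reach into `x :: s` do not contribute, because `t` and `κ` are pure.
  have hsub : range (u.length + 1) ⊆ range ((u ++ x :: s).length + 1) := by
    intro i
    simp only [mem_range, List.length_append]
    omega
  rw [← Finset.sum_subset hsub]
  · refine Finset.sum_congr rfl fun i hi => ?_
    have hi : i ≤ u.length := Nat.lt_succ_iff.1 (mem_range.1 hi)
    rw [List.take_append_of_le_length hi, List.drop_append_of_le_length hi]
    congr 2
    · simp only [blockCoeff, Algebra.algebraMap_self, RingHom.id_apply, ite_self,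
        List.append_eq_nil_iff, reduceCtorEq, and_false, if_false]
      rw [mul_smul, Algebra.smul_def]
    · simp only [blockCoeff, if_false, Algebra.algebraMap_self, RingHom.id_apply]
      rw [mul_smul, Algebra.smul_def]
  · intro i _ hi
    have hi : u.length + 1 ≤ i := by simpa using hi
    have hmem : x ∈ (u ++ x :: s).take i := by
      rw [List.take_append, show i - u.length = (i - u.length - 1) + 1 by omega,
        List.take_succ_cons]
      simp
    simp [blockCoeff, ht a _ ⟨x, hmem, hx⟩, hκ a _ ⟨x, hmem, hx⟩]

/-- A centred polynomial in the letter `a` maps words that start with another letter to words that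
start with `a`. -/
theorem stackRep_mem_headVectors {t : List α → ℂ} {κ : List α → B} (ht : IsPure t)
    (hκ : IsPure κ) {a : α} {p : FreeAlgebra ℂ α}
    (hp : p ∈ Algebra.adjoin ℂ {FreeAlgebra.ι ℂ a}) (h0 : vacuum t t p = 0) {c : α} (hc : c ≠ a)
    {f : List α →₀ B} (hf : f ∈ headVectors B c) : stackRep t κ p f ∈ headVectors B a := by
  rw [← f.sum_single, Finsupp.sum, map_sum]
  refine Submodule.sum_mem _ fun s hs => ?_
  have hs : s.head? = some c := hf hs
  obtain ⟨s, rfl⟩ : ∃ s', s = c :: s' := by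
    cases s with
    | nil => simp at hs
    | cons y s => exact ⟨s, by simpa using hs⟩
  rw [stackRep_single_of_head_ne ht hκ hp hc]
  have hv := stackRep_sub_mem_headVectors t t hp 1
  rw [h0, zero_mul, Finsupp.single_zero, sub_zero] at hv
  rw [← Finsupp.sum_single (stackRep t t p (Finsupp.single [] 1)), Finsupp.sum, map_sum]
  refine Submodule.sum_mem _ fun u hu => ?_
  have hu : u.head? = some a := hv hu
  rw [Finsupp.lsum_single, LinearMap.comp_apply]
  refine Finsupp.single_mem_supported ℂ _ ?_
  cases u with
  | nil => simp at hu
  | cons y u => simpa using hu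

theorem oprod_succ {R : Type*} [Monoid R] {n : ℕ} (a : Fin (n + 1) → R) :
    oprod a = a 0 * oprod fun i => a i.succ := by
  simp [oprod, List.ofFn_succ]

theorem oprod_zero {R : Type*} [Monoid R] (a : Fin 0 → R) : oprod a = 1 := by
  simp [oprod]

theorem map_oprod {R S F : Type*} [Monoid R] [Monoid S] [FunLike F R S] [MonoidHomClass F R S]
    (f : F) {n : ℕ} (a : Fin n → R) : f (oprod a) = oprod fun i => f (a i) := by
  simp [oprod, map_list_prod, List.map_ofFn, Function.comp_def]

/-- An alternating product of centred polynomials maps the vacuum to the product of the expectations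
of the factors, up to words that start with the first letter. -/
theorem stackRep_oprod_sub_mem {t : List α → ℂ} {κ : List α → B} (ht : IsPure t)
    (hκ : IsPure κ) {n : ℕ} (ε : Fin n → α) (a : Fin n → FreeAlgebra ℂ α)
    (ha : ∀ j, a j ∈ Algebra.adjoin ℂ {FreeAlgebra.ι ℂ (ε j)}) (h0 : ∀ j, vacuum t t (a j) = 0)
    (hε : ∀ j k : Fin n, k.val = j.val + 1 → ε j ≠ ε k) :
    ∃ f, (f = 0 ∨ ∃ h : 0 < n, f ∈ headVectors B (ε ⟨0, h⟩)) ∧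
      stackRep t κ (oprod a) (Finsupp.single [] 1) =
        Finsupp.single [] (oprod fun j => vacuum t κ (a j)) + f := by
  induction n with
  | zero => exact ⟨0, Or.inl rfl, by simp [oprod_zero]⟩
  | succ n ih =>
    obtain ⟨f, hf, heq⟩ := ih (fun i => ε i.succ) (fun i => a i.succ) (fun j => ha _)
      (fun j => h0 _) (fun j k hjk => hε _ _ (by simp [hjk]))
    rw [oprod_succ, oprod_succ, map_mul, Module.End.mul_apply, heq, map_add]
    refine ⟨_, Or.inr ⟨n.succ_pos, Submodule.add_mem _
      (stackRep_sub_mem_headVectors t κ (ha 0) (oprod fun j => vacuum t κ (a j.succ)))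
      (?_ : stackRep t κ (a 0) f ∈ _)⟩, by abel⟩
    rcases hf with rfl | ⟨hn, hf⟩
    · simp
    · exact stackRep_mem_headVectors ht hκ (ha 0) (h0 0) (hε 0 (Fin.succ ⟨0, hn⟩) (by simp)).symm hf

theorem vacuum_oprod {t : List α → ℂ} {κ : List α → B} (ht : IsPure t)
    (hκ : IsPure κ) {n : ℕ} (ε : Fin n → α) (a : Fin n → FreeAlgebra ℂ α)
    (ha : ∀ j, a j ∈ Algebra.adjoin ℂ {FreeAlgebra.ι ℂ (ε j)}) (h0 : ∀ j, vacuum t t (a j) = 0)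
    (hε : ∀ j k : Fin n, k.val = j.val + 1 → ε j ≠ ε k) :
    vacuum t κ (oprod a) = oprod fun j => vacuum t κ (a j) := by
  obtain ⟨f, hf, heq⟩ := stackRep_oprod_sub_mem ht hκ ε a ha h0 hε
  have hf0 : f [] = 0 := by
    rcases hf with rfl | ⟨_, hf⟩
    · rfl
    · by_contra h
      simpa using hf (Finsupp.mem_support_iff.2 h)
  rw [vacuum_apply, heq, Finsupp.add_apply, hf0, add_zero, Finsupp.single_eq_same]

theorem cons_adjoin_apply {A : Type*} [Semiring A] [Algebra ℂ A] (Z : Fin 2 → A) (i : Fin 2) :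
    ![Algebra.adjoin ℂ {Z 0}, Algebra.adjoin ℂ {Z 1}] i = Algebra.adjoin ℂ {Z i} := by
  fin_cases i <;> rfl

/-- The stack model of pure weights is c-free. -/
theorem cfree_vacuum {t : List (Fin 2) → ℂ} {κ : List (Fin 2) → B} (ht : IsPure t)
    (hκ : IsPure κ) :
    CFree (vacuum t κ) (vacuum t t) (Algebra.adjoin ℂ {FreeAlgebra.ι ℂ 0})
      (Algebra.adjoin ℂ {FreeAlgebra.ι ℂ 1}) := by
  intro n hn ε a h0 ha hε
  simp only [cons_adjoin_apply (FreeAlgebra.ι ℂ)] at ha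
  refine ⟨?_, vacuum_oprod ht hκ ε a ha h0 hε⟩
  rw [vacuum_oprod ht ht ε a ha h0 hε]
  obtain ⟨m, rfl⟩ : ∃ m, n = m + 1 := ⟨n - 1, by omega⟩
  rw [oprod_succ, h0, zero_mul]

end Model

/-! ### Moments of c-free elements -/

section Moments

variable {B : Type*} [Ring B] [Algebra ℂ B]

theorem CFree.of_map {A P : Type*} [Ring A] [Algebra ℂ A] [Ring P] [Algebra ℂ P] (f : P →ₐ[ℂ] A)
    {Φ : A →ₗ[ℂ] B} {φ : A →ₗ[ℂ] ℂ} {S₁ S₂ : Subalgebra ℂ P} :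
    CFree Φ φ (S₁.map f) (S₂.map f) ↔
      CFree (Φ ∘ₗ f.toLinearMap) (φ ∘ₗ f.toLinearMap) S₁ S₂ := by
  have hS : ∀ i, ![S₁.map f, S₂.map f] i = (![S₁, S₂] i).map f := by
    intro i
    fin_cases i <;> rfl
  constructor
  · intro h n hn ε a h0 ha hε
    have := h n hn ε (fun j => f (a j)) h0 (fun j => by
      rw [hS]
      exact Subalgebra.mem_map.2 ⟨_, ha j, rfl⟩) hε
    rw [← map_oprod] at this
    exact this
  · intro h n hn ε a h0 ha hε
    have : ∀ j, ∃ p, p ∈ ![S₁, S₂] (ε j) ∧ f p = a j := by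
      intro j
      have := ha j
      rw [hS] at this
      exact Subalgebra.mem_map.1 this
    choose p hp hpa using this
    obtain rfl : (fun j => f (p j)) = a := funext hpa
    have := h n hn ε p h0 hp hε
    rw [← map_oprod]
    exact this

/-- The factors `a` are centred polynomials in single letters, and neighbouring letters differ. -/
def IsAltProd {α : Type*} (φ : FreeAlgebra ℂ α →ₗ[ℂ] ℂ) {n : ℕ} (ε : Fin n → α)
    (a : Fin n → FreeAlgebra ℂ α) : Prop :=
  (∀ j, φ (a j) = 0) ∧ (∀ j, a j ∈ Algebra.adjoin ℂ {FreeAlgebra.ι ℂ (ε j)}) ∧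
    ∀ j k : Fin n, k.val = j.val + 1 → ε j ≠ ε k

theorem IsAltProd.tail {α : Type*} {φ : FreeAlgebra ℂ α →ₗ[ℂ] ℂ} {n : ℕ} {ε : Fin (n + 1) → α}
    {a : Fin (n + 1) → FreeAlgebra ℂ α} (h : IsAltProd φ ε a) :
    IsAltProd φ (fun i => ε i.succ) (fun i => a i.succ) :=
  ⟨fun _ => h.1 _, fun _ => h.2.1 _, fun j k hjk => h.2.2 _ _ (by simp [hjk])⟩

/-- The span of the alternating products, the empty one included. -/
def altSpan {α : Type*} (φ : FreeAlgebra ℂ α →ₗ[ℂ] ℂ) : Submodule ℂ (FreeAlgebra ℂ α) :=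
  Submodule.span ℂ {p | ∃ (n : ℕ) (ε : Fin n → α) (a : Fin n → FreeAlgebra ℂ α),
    IsAltProd φ ε a ∧ oprod a = p}

/-- A submodule of the free algebra that contains `1` and is closed under multiplication by letters
from the left is everything. -/
theorem eq_top_of_ι_mul_mem {α : Type*} (N : Submodule ℂ (FreeAlgebra ℂ α)) (h1 : 1 ∈ N)
    (h : ∀ i, ∀ p ∈ N, FreeAlgebra.ι ℂ i * p ∈ N) : N = ⊤ := by
  refine Submodule.eq_top_iff'.2 fun p => ?_
  have := adjoin_invariant (Algebra.lmul ℂ (FreeAlgebra ℂ α)) N (Set.range (FreeAlgebra.ι ℂ))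
    (by rintro _ ⟨i, rfl⟩ m hm; exact h i m hm) (p := p)
    (by rw [FreeAlgebra.adjoin_range_ι]; trivial) h1
  simpa using this

theorem mul_mem_altSpan {α : Type*} {φ : FreeAlgebra ℂ α →ₗ[ℂ] ℂ} (hφ : φ 1 = 1) {n : ℕ}
    {ε : Fin n → α} {a : Fin n → FreeAlgebra ℂ α} (h : IsAltProd φ ε a) {i : α}
    {p : FreeAlgebra ℂ α} (hp : p ∈ Algebra.adjoin ℂ {FreeAlgebra.ι ℂ i}) :
    p * oprod a ∈ altSpan φ := by
  -- It suffices to split off the expectation of `p`, if the next factor has another letter.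
  have key : ∀ {n : ℕ} {ε : Fin n → α} {a : Fin n → FreeAlgebra ℂ α}, IsAltProd φ ε a →
      (∀ h : 0 < n, i ≠ ε ⟨0, h⟩) → ∀ p ∈ Algebra.adjoin ℂ {FreeAlgebra.ι ℂ i},
      p * oprod a ∈ altSpan φ := by
    intro n ε a h hne p hp
    have hsplit : p * oprod a = φ p • oprod a +
        oprod (Fin.cons (p - algebraMap ℂ _ (φ p)) a : Fin (n + 1) → FreeAlgebra ℂ α) := by
      rw [oprod_succ]
      simp only [Fin.cons_zero, Fin.cons_succ, sub_mul, Algebra.smul_def]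
      abel
    rw [hsplit]
    refine Submodule.add_mem _ (Submodule.smul_mem _ _ (Submodule.subset_span ⟨n, ε, a, h, rfl⟩))
      (Submodule.subset_span ⟨n + 1, Fin.cons i ε, _, ⟨?_, ?_, ?_⟩, rfl⟩)
    · intro j
      refine Fin.cases ?_ (fun j => ?_) j
      · simp [Algebra.algebraMap_eq_smul_one, hφ]
      · simpa using h.1 j
    · intro j
      refine Fin.cases ?_ (fun j => ?_) j
      · simpa using Subalgebra.sub_mem _ hp (Subalgebra.algebraMap_mem _ _)
      · simpa using h.2.1 j
    · intro j k hjk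
      obtain ⟨k, rfl⟩ := Fin.exists_succ_eq.2 (show k ≠ 0 by rintro rfl; simp at hjk)
      rcases Fin.eq_zero_or_eq_succ j with rfl | ⟨j, rfl⟩
      · have hk : k = ⟨0, k.pos⟩ := Fin.ext (by simpa using hjk)
        rw [Fin.cons_zero, Fin.cons_succ, hk]
        exact hne _
      · simpa using h.2.2 j k (by simpa using hjk)
  cases n with
  | zero => exact key h (fun h => absurd h (lt_irrefl _)) p hp
  | succ n =>
    by_cases hi : i = ε 0
    · rw [oprod_succ, ← mul_assoc]
      refine key h.tail (fun hn => ?_) _ (mul_mem hp (hi ▸ h.2.1 0))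
      rw [hi]
      exact h.2.2 _ _ (by simp)
    · exact key h (fun _ => hi) p hp

theorem altSpan_eq_top {α : Type*} {φ : FreeAlgebra ℂ α →ₗ[ℂ] ℂ} (hφ : φ 1 = 1) :
    altSpan φ = ⊤ := by
  refine eq_top_of_ι_mul_mem _ (Submodule.subset_span ⟨0, Fin.elim0, Fin.elim0,
    ⟨fun j => j.elim0, fun j => j.elim0, fun j => j.elim0⟩, oprod_zero _⟩) fun i p hp => ?_
  induction hp using Submodule.span_induction with
  | mem p hp =>
    obtain ⟨n, ε, a, h, rfl⟩ := hp
    exact mul_mem_altSpan hφ h (Algebra.self_mem_adjoin_singleton ℂ _)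
  | zero => simp
  | add p q _ _ hp hq => rw [mul_add]; exact Submodule.add_mem _ hp hq
  | smul z p _ hp => rw [mul_smul_comm]; exact Submodule.smul_mem _ z hp

/-- Linear maps that agree on all words are equal. -/
theorem ext_of_words {α : Type*} {F G : FreeAlgebra ℂ α →ₗ[ℂ] B}
    (h : ∀ (n : ℕ) (c : Fin n → α), F (oprod fun i => FreeAlgebra.ι ℂ (c i)) =
      G (oprod fun i => FreeAlgebra.ι ℂ (c i))) : F = G := by
  have : Submodule.span ℂ {p | ∃ (n : ℕ) (c : Fin n → α),
      (oprod fun i => FreeAlgebra.ι ℂ (c i)) = p} = ⊤ := by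
    refine eq_top_of_ι_mul_mem _ (Submodule.subset_span ⟨0, Fin.elim0, oprod_zero _⟩)
      fun i p hp => ?_
    induction hp using Submodule.span_induction with
    | mem p hp =>
      obtain ⟨n, c, rfl⟩ := hp
      refine Submodule.subset_span ⟨n + 1, Fin.cons i c, ?_⟩
      rw [oprod_succ]
      simp
    | zero => simp
    | add p q _ _ hp hq => rw [mul_add]; exact Submodule.add_mem _ hp hq
    | smul z p _ hp => rw [mul_smul_comm]; exact Submodule.smul_mem _ z hp
  refine LinearMap.ext_on this ?_
  rintro _ ⟨n, c, rfl⟩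
  exact h n c

/-- Linear maps that agree on the powers of a letter agree on its polynomials. -/
theorem eq_on_adjoin_of_powers {α : Type*} {F G : FreeAlgebra ℂ α →ₗ[ℂ] B} {a : α}
    (h : ∀ n, F (oprod fun _ : Fin n => FreeAlgebra.ι ℂ a) =
      G (oprod fun _ : Fin n => FreeAlgebra.ι ℂ a)) {p : FreeAlgebra ℂ α}
    (hp : p ∈ Algebra.adjoin ℂ {FreeAlgebra.ι ℂ a}) : F p = G p := by
  have hp : p ∈ Submodule.span ℂ (Submonoid.closure {FreeAlgebra.ι ℂ a} : Set _) := by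
    rw [← Algebra.adjoin_eq_span]
    exact hp
  refine LinearMap.eqOn_span (fun x hx => ?_) hp
  obtain ⟨n, rfl⟩ := Submonoid.mem_closure_singleton.1 hx
  simpa [oprod] using h n

/-- C-freeness and the values on the two subalgebras determine a pair of maps. -/
theorem eq_of_cfree {φ ψ : FreeAlgebra ℂ (Fin 2) →ₗ[ℂ] ℂ} {Φ Ψ : FreeAlgebra ℂ (Fin 2) →ₗ[ℂ] B}
    (hφ1 : φ 1 = 1) (hψ1 : ψ 1 = 1) (hΦ1 : Φ 1 = 1) (hΨ1 : Ψ 1 = 1)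
    (hφ : CFree Φ φ (Algebra.adjoin ℂ {FreeAlgebra.ι ℂ 0}) (Algebra.adjoin ℂ {FreeAlgebra.ι ℂ 1}))
    (hψ : CFree Ψ ψ (Algebra.adjoin ℂ {FreeAlgebra.ι ℂ 0}) (Algebra.adjoin ℂ {FreeAlgebra.ι ℂ 1}))
    (h : ∀ i, ∀ p ∈ Algebra.adjoin ℂ {FreeAlgebra.ι ℂ i}, φ p = ψ p)
    (H : ∀ i, ∀ p ∈ Algebra.adjoin ℂ {FreeAlgebra.ι ℂ i}, Φ p = Ψ p) : φ = ψ ∧ Φ = Ψ := by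
  have key : ∀ p ∈ {p | ∃ (n : ℕ) (ε : Fin n → Fin 2) (a : Fin n → FreeAlgebra ℂ (Fin 2)),
      IsAltProd φ ε a ∧ oprod a = p}, φ p = ψ p ∧ Φ p = Ψ p := by
    rintro _ ⟨n, ε, a, ⟨h0, ha, hε⟩, rfl⟩
    rcases Nat.eq_zero_or_pos n with rfl | hn
    · simp [oprod_zero, hφ1, hψ1, hΦ1, hΨ1]
    have ha' : ∀ j, a j ∈ ![Algebra.adjoin ℂ {FreeAlgebra.ι ℂ 0},
        Algebra.adjoin ℂ {FreeAlgebra.ι ℂ 1}] (ε j) := by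
      intro j
      rw [cons_adjoin_apply (FreeAlgebra.ι ℂ)]
      exact ha j
    obtain ⟨h1, h2⟩ := hφ n hn ε a h0 ha' hε
    obtain ⟨h3, h4⟩ := hψ n hn ε a (fun j => (h _ _ (ha j)).symm.trans (h0 j)) ha' hε
    refine ⟨h1.trans h3.symm, h2.trans (Eq.trans ?_ h4.symm)⟩
    congr 1
    funext j
    exact H _ _ (ha j)
  exact ⟨LinearMap.ext_on (altSpan_eq_top hφ1) fun p hp => (key p hp).1,
    LinearMap.ext_on (altSpan_eq_top hφ1) fun p hp => (key p hp).2⟩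

end Moments

/-! ### Coefficients as weights of words -/

section Words

variable {α B : Type*} [Ring B] [Algebra ℂ B]

/-- The summand of a partition `π` of the positions of the word `c`, for weights `t` of interior and
`κ` of exterior blocks. -/
noncomputable def wordWeight {n : ℕ} (t : List α → ℂ) (κ : List α → B) (c : Fin n → α)
    (π : Finset (Finset (Fin n))) : B :=
  ((∏ D ∈ intBlocks π, t (subword c D)) * ∏ p ∈ nonMinima π, t [c p]) •
    ((extList π).map fun C => κ (subword c C)).prod

theorem vacuum_word {n : ℕ} (t : List α → ℂ) (κ : List α → B) (c : Fin n → α) :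
    vacuum t κ (oprod fun i => FreeAlgebra.ι ℂ (c i)) = ∑ π ∈ NCL n, wordWeight t κ c π := by
  rw [vacuum_apply, map_oprod]
  simp only [stackRep_ι]
  exact stackOp_prod_apply_nil t κ c

theorem wordWeight_congr {n : ℕ} {t t' : List α → ℂ} {κ κ' : List α → B} {c : Fin n → α}
    {π : Finset (Finset (Fin n))} (h1 : ∀ a, t [a] = t' [a])
    (ht : ∀ C ∈ π, t (subword c C) = t' (subword c C))
    (hκ : ∀ C ∈ π, κ (subword c C) = κ' (subword c C)) :
    wordWeight t κ c π = wordWeight t' κ' c π := by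
  rw [wordWeight, wordWeight]
  congr 1
  · congr 1
    · exact Finset.prod_congr rfl fun D hD => ht D (mem_of_mem_intBlocks hD)
    · exact Finset.prod_congr rfl fun p _ => h1 _
  · congr 1
    exact List.map_congr_left fun C hC => hκ C (mem_of_mem_extList hC)

theorem subword_univ {n : ℕ} (c : Fin n → α) : subword c univ = List.ofFn c := by
  rw [subword, Fin.sort_univ, List.ofFn_eq_map]

theorem wordWeight_univ {n : ℕ} (hn : 1 ≤ n) (t : List α → ℂ) (κ : List α → B) (c : Fin n → α) :
    wordWeight t κ c {univ} =
      (∏ p : Fin n with 0 < p.val, t [c p]) • κ (List.ofFn c) := by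
  simp [wordWeight, intBlocks_univ, nonMinima_univ, extList_univ hn, subword_univ]

theorem length_subword {n : ℕ} (c : Fin n → α) (C : Finset (Fin n)) :
    (subword c C).length = C.card := by
  rw [subword, List.length_map, Finset.length_sort]

/-- The recurrence determines the weight of a word from its moment and from the weights of shorter
words. -/
theorem weight_eq_of_sum_eq {t t' : List α → ℂ} {κ κ' : List α → B} (h1 : ∀ a, t [a] = t' [a])
    (h0 : ∀ a, t [a] ≠ 0) {n : ℕ} (hn : 1 ≤ n) (c : Fin n → α)
    (ht : ∀ l : List α, l.length < n → t l = t' l) (hκ : ∀ l : List α, l.length < n → κ l = κ' l)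
    (h : ∑ π ∈ NCL n, wordWeight t κ c π = ∑ π ∈ NCL n, wordWeight t' κ' c π) :
    κ (List.ofFn c) = κ' (List.ofFn c) := by
  rw [sum_NCL hn, sum_NCL hn, Finset.sum_congr rfl fun π hπ => wordWeight_congr h1
      (fun C hC => ht _ ((length_subword c C).trans_lt (card_lt_of_mem (mem_filter.1 hπ).2 hC)))
      fun C hC => hκ _ ((length_subword c C).trans_lt (card_lt_of_mem (mem_filter.1 hπ).2 hC)),
    add_left_inj, wordWeight_univ hn, wordWeight_univ hn] at h
  simp only [← h1] at h
  exact smul_right_injective B (Finset.prod_ne_zero_iff.2 fun p _ => h0 (c p)) h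

open scoped Classical in
/-- The pure part of a family of weights: the weights of words with different letters are replaced
by `0`. -/
noncomputable def purePart {M : Type*} [Zero M] (F : List α → M) (l : List α) : M :=
  if ∃ a, ∀ x ∈ l, x = a then F l else 0

theorem isPure_purePart {M : Type*} [Zero M] (F : List α → M) : IsPure (purePart F) := by
  rintro a l ⟨x, hx, hxa⟩
  refine if_neg ?_
  rintro ⟨y, hy⟩
  exact hxa ((hy x (by simp [hx])).trans (hy a (by simp)).symm)

theorem purePart_of_forall_eq {M : Type*} [Zero M] (F : List α → M) {l : List α} {a : α}
    (h : ∀ x ∈ l, x = a) : purePart F l = F l :=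
  if_pos ⟨a, h⟩

end Words

section CoeffWords

variable {A : Type*} [Ring A] [Algebra ℂ A] {B : Type*} [Ring B] [Algebra ℂ B]
  {α : Type*} (Φ : A →ₗ[ℂ] B) (φ : A →ₗ[ℂ] ℂ) (Z : α → A)

/-- The `t`-coefficient of the tuple that the word `l` spells. -/
noncomputable def tWord (l : List α) : ℂ := tCoeff φ l.length fun i => Z (l.get i)

/-- The `ᶜt`-coefficient of the tuple that the word `l` spells. -/
noncomputable def ctWord (l : List α) : B := ctCoeff Φ φ l.length fun i => Z (l.get i)

set_option linter.unusedSectionVars false in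
theorem restr_eq_subword {M : Type*} (F : (m : ℕ) → (Fin m → A) → M) {n : ℕ} (c : Fin n → α)
    (C : Finset (Fin n)) : F C.card (restr (fun i => Z (c i)) C) =
      F (subword c C).length fun i => Z ((subword c C).get i) := by
  have key : ∀ (m : ℕ) (h : (subword c C).length = m),
      F (subword c C).length (fun i => Z ((subword c C).get i)) =
        F m fun i => Z ((subword c C).get (i.cast h.symm)) := by
    rintro m rfl
    rfl
  rw [key _ (length_subword c C)]
  congr 1
  funext i
  simp only [restr, subword, Finset.orderEmbOfFin_apply, List.get_eq_getElem, List.getElem_map]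
  rfl

theorem tWord_ofFn {n : ℕ} (c : Fin n → α) :
    tWord φ Z (List.ofFn c) = tCoeff φ n fun i => Z (c i) := by
  rw [← restr_univ (tCoeff φ), restr_eq_subword Z (tCoeff φ), ← subword_univ]
  rfl

theorem ctWord_ofFn {n : ℕ} (c : Fin n → α) :
    ctWord Φ φ Z (List.ofFn c) = ctCoeff Φ φ n fun i => Z (c i) := by
  rw [← restr_univ (ctCoeff Φ φ), restr_eq_subword Z (ctCoeff Φ φ), ← subword_univ]
  rfl

theorem tWord_singleton (a : α) : tWord φ Z [a] = φ (Z a) := tCoeff_one φ _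

theorem ctPi_eq_wordWeight {n : ℕ} (c : Fin n → α) (π : Finset (Finset (Fin n))) :
    ctPi Φ φ π (fun i => Z (c i)) = wordWeight (tWord φ Z) (ctWord Φ φ Z) c π := by
  simp only [ctPi, wordWeight, restr_eq_subword Z (tCoeff φ), restr_eq_subword Z (ctCoeff Φ φ),
    tCoeff_one, tWord_singleton]
  rfl

theorem tPi_eq_wordWeight {n : ℕ} (c : Fin n → α) {π : Finset (Finset (Fin n))} (hπ : IsNCL π) :
    tPi φ π (fun i => Z (c i)) = wordWeight (tWord φ Z) (tWord φ Z) c π := by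
  have h := hπ.prod_eq fun C => tWord φ Z (subword c C)
  have h' : ∏ C ∈ π, tCoeff φ C.card (restr (fun i => Z (c i)) C) =
      ∏ C ∈ π, tWord φ Z (subword c C) :=
    Finset.prod_congr rfl fun C _ => restr_eq_subword Z (tCoeff φ) c C
  rw [tPi, h', ← h, wordWeight, smul_eq_mul]
  simp only [tCoeff_one, tWord_singleton]
  ring

variable {Z}

theorem phi_word (hZ : ∀ a, φ (Z a) ≠ 0) {n : ℕ} (hn : 1 ≤ n) (c : Fin n → α) :
    φ (FreeAlgebra.lift ℂ Z (oprod fun i => FreeAlgebra.ι ℂ (c i))) =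
      ∑ π ∈ NCL n, wordWeight (tWord φ Z) (tWord φ Z) c π := by
  rw [map_oprod]
  simp only [FreeAlgebra.lift_ι_apply]
  rw [phi_oprod φ hn _ fun p _ => hZ (c p)]
  exact Finset.sum_congr rfl fun π hπ => tPi_eq_wordWeight φ Z c (mem_NCL.1 hπ)

theorem Phi_word (hZ : ∀ a, φ (Z a) ≠ 0) {n : ℕ} (hn : 1 ≤ n) (c : Fin n → α) :
    Φ (FreeAlgebra.lift ℂ Z (oprod fun i => FreeAlgebra.ι ℂ (c i))) =
      ∑ π ∈ NCL n, wordWeight (tWord φ Z) (ctWord Φ φ Z) c π := by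
  rw [map_oprod]
  simp only [FreeAlgebra.lift_ι_apply]
  rw [Phi_oprod Φ φ hn _ fun p _ => hZ (c p)]
  exact Finset.sum_congr rfl fun π _ => ctPi_eq_wordWeight Φ φ Z c π

/-- The given maps, pulled back to the free algebra, are those of the stack model with the
coefficients as weights. -/
theorem comp_lift_eq_vacuum (hZ : ∀ a, φ (Z a) ≠ 0) (hΦ : Φ 1 = 1) (hφ : φ 1 = 1) :
    φ ∘ₗ (FreeAlgebra.lift ℂ Z).toLinearMap = vacuum (tWord φ Z) (tWord φ Z) ∧
      Φ ∘ₗ (FreeAlgebra.lift ℂ Z).toLinearMap = vacuum (tWord φ Z) (ctWord Φ φ Z) := by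
  constructor <;> refine ext_of_words fun n c => ?_ <;> rcases Nat.eq_zero_or_pos n with rfl | hn
  · simp [oprod_zero, vacuum_one, hφ]
  · rw [vacuum_word]
    exact phi_word φ hZ hn c
  · simp [oprod_zero, vacuum_one, hΦ]
  · rw [vacuum_word]
    exact Phi_word Φ φ hZ hn c

theorem purePart_singleton {M : Type*} [Zero M] (F : List α → M) (a : α) :
    purePart F [a] = F [a] := purePart_of_forall_eq F (a := a) (by simp)

/-- The stack model determines its weights: `φ` those of the interior blocks and `Φ` those of the
exterior ones. -/
theorem weights_eq_of_vacuum_eq {t t' : List α → ℂ} {κ κ' : List α → B} (h0 : ∀ a, t [a] ≠ 0)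
    (h1 : ∀ a, t [a] = t' [a]) (hnil : t [] = t' [] ∧ κ [] = κ' [])
    (h : vacuum t t = vacuum t' t') (H : vacuum t κ = vacuum t' κ') : t = t' ∧ κ = κ' := by
  have key : ∀ l, t l = t' l ∧ κ l = κ' l := by
    intro l
    induction hN : l.length using Nat.strong_induction_on generalizing l with
    | _ N ih =>
      rcases List.eq_nil_or_concat l with rfl | ⟨_, _, hl⟩
      · exact hnil
      have hn : 1 ≤ l.length := by simp [hl]
      have h2 := fun m (hm : m.length < l.length) => ih m.length (hN ▸ hm) m rfl
      have e1 := weight_eq_of_sum_eq h1 h0 hn l.get (fun m hm => (h2 m hm).1)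
        (fun m hm => (h2 m hm).1) (by rw [← vacuum_word, ← vacuum_word, h])
      have e2 := weight_eq_of_sum_eq h1 h0 hn l.get (fun m hm => (h2 m hm).1)
        (fun m hm => (h2 m hm).2) (by rw [← vacuum_word, ← vacuum_word, H])
      rw [List.ofFn_get] at e1 e2
      exact ⟨e1, e2⟩
  exact ⟨funext fun l => (key l).1, funext fun l => (key l).2⟩

/-- The mixed coefficients vanish if and only if the weights of words are pure. -/
theorem mixedCoeffsVanish_iff (X Y : A) : MixedCoeffsVanish Φ φ X Y ↔
    tWord φ ![X, Y] = purePart (tWord φ ![X, Y]) ∧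
      ctWord Φ φ ![X, Y] = purePart (ctWord Φ φ ![X, Y]) := by
  have hmix : ∀ l : List (Fin 2), (¬ ∃ a, ∀ x ∈ l, x = a) ↔ 0 ∈ l ∧ 1 ∈ l := by
    intro l
    constructor
    · intro h
      push Not at h
      obtain ⟨x, hx, hx1⟩ := h 1
      obtain ⟨y, hy, hy0⟩ := h 0
      rw [show x = 0 by omega] at hx
      rw [show y = 1 by omega] at hy
      exact ⟨hx, hy⟩
    · rintro ⟨h0, h1⟩ ⟨a, ha⟩
      exact absurd ((ha 0 h0).trans (ha 1 h1).symm) (by decide)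
  constructor
  · intro h
    constructor <;> funext l <;> by_cases hl : ∃ a, ∀ x ∈ l, x = a
    · rw [purePart, if_pos hl]
    · rw [purePart, if_neg hl]
      obtain ⟨h0, h1⟩ := (hmix l).1 hl
      exact (h l.length l.get (List.mem_iff_get.1 h0) (List.mem_iff_get.1 h1)).2
    · rw [purePart, if_pos hl]
    · rw [purePart, if_neg hl]
      obtain ⟨h0, h1⟩ := (hmix l).1 hl
      exact (h l.length l.get (List.mem_iff_get.1 h0) (List.mem_iff_get.1 h1)).1
  · rintro ⟨h1, h2⟩ n c h0 h0'
    have hl := (hmix (List.ofFn c)).2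
      ⟨List.mem_ofFn.2 h0, List.mem_ofFn.2 h0'⟩
    have e1 := congrFun h1 (List.ofFn c)
    have e2 := congrFun h2 (List.ofFn c)
    rw [purePart, if_neg hl, tWord_ofFn] at e1
    rw [purePart, if_neg hl, ctWord_ofFn] at e2
    exact ⟨e2, e1⟩

/-- On the polynomials in one letter the stack model only sees the pure part of the weights. -/
theorem vacuum_purePart_eq_on_adjoin (t : List α → ℂ) (κ : List α → B) {a : α}
    {p : FreeAlgebra ℂ α} (hp : p ∈ Algebra.adjoin ℂ {FreeAlgebra.ι ℂ a}) :
    vacuum t κ p = vacuum (purePart t) (purePart κ) p := by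
  refine eq_on_adjoin_of_powers (fun n => ?_) hp
  have hall : ∀ C : Finset (Fin n), ∀ x ∈ subword (fun _ => a) C, x = a := by
    intro C x hx
    obtain ⟨_, _, rfl⟩ := List.mem_map.1 hx
    rfl
  rw [vacuum_word t κ fun _ => a, vacuum_word _ _ fun _ => a]
  exact Finset.sum_congr rfl fun π _ => wordWeight_congr
    (fun b => (purePart_singleton t b).symm)
    (fun C _ => (purePart_of_forall_eq t (hall C)).symm)
    (fun C _ => (purePart_of_forall_eq κ (hall C)).symm)

/-- The algebraic form of the result: no topology is involved. -/
theorem cfree_iff_mixedCoeffsVanish (hΦ : Φ 1 = 1) (hφ : φ 1 = 1) {X Y : A} (hX : φ X ≠ 0)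
    (hY : φ Y ≠ 0) : CFree Φ φ (Algebra.adjoin ℂ {X}) (Algebra.adjoin ℂ {Y}) ↔
      MixedCoeffsVanish Φ φ X Y := by
  have hZ : ∀ a, φ ((![X, Y] : Fin 2 → A) a) ≠ 0 := by
    intro a
    fin_cases a
    · exact hX
    · exact hY
  obtain ⟨h1, h2⟩ := comp_lift_eq_vacuum Φ φ hZ hΦ hφ
  have hgen : ∀ a, (Algebra.adjoin ℂ {FreeAlgebra.ι ℂ a}).map (FreeAlgebra.lift ℂ ![X, Y]) =
      Algebra.adjoin ℂ {(![X, Y] : Fin 2 → A) a} := by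
    intro a
    rw [AlgHom.map_adjoin, Set.image_singleton, FreeAlgebra.lift_ι_apply]
  have hcf := CFree.of_map (FreeAlgebra.lift ℂ ![X, Y]) (Φ := Φ) (φ := φ)
    (S₁ := Algebra.adjoin ℂ {FreeAlgebra.ι ℂ 0}) (S₂ := Algebra.adjoin ℂ {FreeAlgebra.ι ℂ 1})
  rw [hgen, hgen, h1, h2] at hcf
  refine hcf.trans ?_
  rw [mixedCoeffsVanish_iff]
  have hpure := cfree_vacuum (isPure_purePart (tWord φ ![X, Y]))
    (isPure_purePart (ctWord Φ φ ![X, Y]))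
  constructor
  · intro h
    obtain ⟨e1, e2⟩ := eq_of_cfree (vacuum_one _ _) (vacuum_one _ _) (vacuum_one _ _)
      (vacuum_one _ _) h hpure (fun _ _ hp => vacuum_purePart_eq_on_adjoin _ _ hp)
      (fun _ _ hp => vacuum_purePart_eq_on_adjoin _ _ hp)
    refine weights_eq_of_vacuum_eq (fun a => ?_) (fun a => (purePart_singleton _ a).symm)
      ⟨(purePart_of_forall_eq (a := 0) _ (by simp)).symm,
        (purePart_of_forall_eq (a := 0) _ (by simp)).symm⟩ e1 e2
    rw [tWord_singleton]
    exact hZ a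
  · rintro ⟨e1, e2⟩
    rwa [← e1, ← e2] at hpure

end CoeffWords

/-! ### C-freeness of closures -/

section Closure

variable {A B : Type*} [Ring A] [Algebra ℂ A] [Ring B] [Algebra ℂ B]

theorem CFree.mono {Φ : A →ₗ[ℂ] B} {φ : A →ₗ[ℂ] ℂ} {S₁ S₂ T₁ T₂ : Subalgebra ℂ A}
    (h : CFree Φ φ T₁ T₂) (h₁ : S₁ ≤ T₁) (h₂ : S₂ ≤ T₂) : CFree Φ φ S₁ S₂ := by
  have hle : ∀ i, ![S₁, S₂] i ≤ ![T₁, T₂] i := by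
    intro i
    fin_cases i
    · exact h₁
    · exact h₂
  exact fun n hn ε a h0 ha hε => h n hn ε a h0 (fun j => hle _ (ha j)) hε

theorem continuous_oprod {R : Type*} [Monoid R] [TopologicalSpace R] [ContinuousMul R] (n : ℕ) :
    Continuous (oprod : (Fin n → R) → R) := by
  have : (oprod : (Fin n → R) → R) = fun a => ((List.finRange n).map a).prod :=
    funext fun a => by rw [oprod, List.ofFn_eq_map]
  rw [this]
  exact continuous_list_prod _ fun i _ => continuous_apply i

/-- C-freeness passes to norm closures, since centred elements of a closure are limits of centred
elements. -/
theorem CFree.topologicalClosure [TopologicalSpace A] [IsTopologicalRing A]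
    [TopologicalSpace B] [IsTopologicalRing B] [T2Space B] [ContinuousSMul ℂ A]
    {Φ : A →ₗ[ℂ] B} {φ : A →ₗ[ℂ] ℂ}
    (hΦ : Continuous Φ) (hφ : Continuous φ) (hφ1 : φ 1 = 1) {S₁ S₂ : Subalgebra ℂ A}
    (h : CFree Φ φ S₁ S₂) : CFree Φ φ S₁.topologicalClosure S₂.topologicalClosure := by
  intro n hn ε a h0 ha hε
  have hS : ∀ i, ![S₁.topologicalClosure, S₂.topologicalClosure] i =
      (![S₁, S₂] i).topologicalClosure := by
    intro i
    fin_cases i <;> rfl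
  -- Centring is continuous and fixes `a`, so `a` is the limit of centred tuples.
  let c : (Fin n → A) → Fin n → A := fun b j => b j - algebraMap ℂ A (φ (b j))
  have hc : Continuous c := by
    have : Continuous (algebraMap ℂ A) := continuous_algebraMap ℂ A
    fun_prop
  have hca : c a = a := by
    funext j
    simp [c, h0 j]
  have hmem : a ∈ closure (Set.univ.pi fun j => (![S₁, S₂] (ε j) : Set A)) := by
    rw [closure_pi_set]
    intro j _
    have := ha j
    rwa [hS] at this
  have hcb : ∀ b ∈ Set.univ.pi (fun j => (![S₁, S₂] (ε j) : Set A)),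
      φ (oprod (c b)) = 0 ∧ Φ (oprod (c b)) = oprod fun j => Φ (c b j) := by
    intro b hb
    refine h n hn ε (c b) (fun j => ?_) (fun j => ?_) hε
    · simp [c, Algebra.algebraMap_eq_smul_one, hφ1]
    · exact Subalgebra.sub_mem _ (hb j trivial) (Subalgebra.algebraMap_mem _ _)
  have hclosed : IsClosed {b : Fin n → A |
      φ (oprod (c b)) = 0 ∧ Φ (oprod (c b)) = oprod fun j => Φ (c b j)} := by
    refine (isClosed_eq (hφ.comp ((continuous_oprod n).comp hc)) continuous_const).inter
      (isClosed_eq (hΦ.comp ((continuous_oprod n).comp hc)) ((continuous_oprod n).comp ?_))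
    exact continuous_pi fun j => hΦ.comp ((continuous_apply j).comp hc)
  have h' : φ (oprod (c a)) = 0 ∧ Φ (oprod (c a)) = oprod fun j => Φ (c a j) :=
    closure_minimal hcb hclosed hmem
  rwa [hca] at h'

end Closure

section CStar

variable {A : Type*} [CStarAlgebra A]

theorem adjoin_le_elemental (X : A) :
    Algebra.adjoin ℂ {X} ≤ (StarAlgebra.elemental ℂ X).toSubalgebra :=
  Algebra.adjoin_le (Set.singleton_subset_iff.2 (StarAlgebra.elemental.self_mem ℂ X))

/-- If `X*` lies in the closed unital subalgebra generated by `X`, that algebra is the unital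
C*-subalgebra generated by `X`. -/
theorem elemental_le_topologicalClosure {X : A}
    (h : star X ∈ (Algebra.adjoin ℂ {X}).topologicalClosure) :
    (StarAlgebra.elemental ℂ X).toSubalgebra ≤ (Algebra.adjoin ℂ {X}).topologicalClosure := by
  have h1 : (StarAlgebra.adjoin ℂ {X}).toSubalgebra ≤
      (Algebra.adjoin ℂ {X}).topologicalClosure := by
    rw [StarAlgebra.adjoin_toSubalgebra]
    refine Algebra.adjoin_le ?_
    rintro x (rfl | hx)
    · exact Subalgebra.le_topologicalClosure _ (Algebra.self_mem_adjoin_singleton ℂ x)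
    · rw [Set.mem_star, Set.mem_singleton_iff] at hx
      rwa [← star_star x, hx]
  intro x hx
  exact closure_minimal h1 (Subalgebra.isClosed_topologicalClosure _) hx

end CStar

end CFreeness

theorem mainTheorem2 :
    -- unital Banach algebras; c-freeness of the generated unital subalgebras
    (∀ (A : Type*) (B : Type*) [NormedRing A] [NormedAlgebra ℂ A] [CompleteSpace A]
        [NormedRing B] [NormedAlgebra ℂ B] [CompleteSpace B]
        (Φ : A →ₗ[ℂ] B) (φ : A →ₗ[ℂ] ℂ), Φ 1 = 1 → φ 1 = 1 →
        ∀ X ∈ CFreeness.Acirc φ, ∀ Y ∈ CFreeness.Acirc φ,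
          (CFreeness.CFree Φ φ (Algebra.adjoin ℂ {X}) (Algebra.adjoin ℂ {Y}) ↔
            CFreeness.MixedCoeffsVanish Φ φ X Y)) ∧
    -- unital C*-algebras, positive `φ`, completely positive `Φ`; c-freeness of the generated
    -- unital C*-subalgebras
    (∀ (A : Type*) (B : Type*) [CStarAlgebra A] [PartialOrder A] [StarOrderedRing A]
        [CStarAlgebra B] [PartialOrder B] [StarOrderedRing B]
        (Φ : A →CP B) (φ : A →ₚ[ℂ] ℂ), Φ 1 = 1 → φ 1 = 1 →
        ∀ X ∈ CFreeness.Acirc φ.toLinearMap, ∀ Y ∈ CFreeness.Acirc φ.toLinearMap,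
          (CFreeness.CFree Φ.toLinearMap φ.toLinearMap
              (StarAlgebra.elemental ℂ X).toSubalgebra (StarAlgebra.elemental ℂ Y).toSubalgebra →
            CFreeness.MixedCoeffsVanish Φ.toLinearMap φ.toLinearMap X Y) ∧
          (star X ∈ (Algebra.adjoin ℂ {X}).topologicalClosure →
            star Y ∈ (Algebra.adjoin ℂ {Y}).topologicalClosure →
            CFreeness.MixedCoeffsVanish Φ.toLinearMap φ.toLinearMap X Y →
            CFreeness.CFree Φ.toLinearMap φ.toLinearMap
              (StarAlgebra.elemental ℂ X).toSubalgebra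
              (StarAlgebra.elemental ℂ Y).toSubalgebra)) := by
  refine ⟨fun A B _ _ _ _ _ _ Φ φ hΦ hφ X hX Y hY =>
    CFreeness.cfree_iff_mixedCoeffsVanish Φ φ hΦ hφ hX hY, ?_⟩
  intro A B _ _ _ _ _ _ Φ φ hΦ hφ X hX Y hY
  have hiff := CFreeness.cfree_iff_mixedCoeffsVanish Φ.toLinearMap φ.toLinearMap hΦ hφ hX hY
  refine ⟨fun h => hiff.1 (h.mono (CFreeness.adjoin_le_elemental X)
    (CFreeness.adjoin_le_elemental Y)), fun hsX hsY h => ?_⟩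
  have hΦc : Continuous Φ.toLinearMap := map_continuous Φ
  have hφc : Continuous φ.toLinearMap := map_continuous φ
  exact (CFreeness.CFree.topologicalClosure hΦc hφc hφ (hiff.2 h)).mono
    (CFreeness.elemental_le_topologicalClosure hsX) (CFreeness.elemental_le_topologicalClosure hsY)
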